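/- For integers $n\ge 1$ and $0<\alpha<1$ let $\mathcal T_{\alpha,n}$ be the rooted tree whose root has $m=\lceil n^{\alpha}\rceil$ children, each of which is the starting point of a path with $l=\lceil n^{1-\alpha}\rceil$ vertices (so $\mathcal T_{\alpha,n}$ has $ml+1$ vertices). A flow on a rooted tree with vertex set $I$ is a vector $\mu\in\mathbb R^{I}$ such that $\mu_i\ge\sum_{j}\mu_j$ for every vertex $i$, the sum being over the children $j$ of $i$ (it is $0$ if $i$ is a leaf); $\mathcal F(\mathcal T_{\alpha,n})$ denotes the closed convex cone of flows on $\mathcal T_{\alpha,n}$, and $\mu_1$ the value of $\mu$ at the root. One observes $Y_i=\mu_i+\epsilon_i$ for all vertices $i$, where $\mu$ is a flow and the $\epsilon_i$ are independent with law $N(0,\sigma^2)$, $\sigma\ge 0$. The least squares estimator $\hat\mu$ is the unique minimizer of $\sum_i (Y_i-f_i)^2$ over $f\in\mathcal F(\mathcal T_{\alpha,n})$. There is a universal constant $C>0$ such that for all integers $n\ge 1$ and all real $\sigma\ge 0$, $V\ge 0$, $$ \sup_{\mu\in\mathcal F(\mathcal T_{\alpha,n}):\ \mu_1\le V}\mathbb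 E\,\frac1n\|\hat\mu-\mu\|^2\ \le\ \begin{cases} \displaystyle 2\Big(\frac{\sigma^2V\log(en)}{n}\Big)^{2/3}+\frac{\sigma^2\log(en)}{n^{1-\alpha}} & \text{if } 0<\alpha\le\frac13,\\[10pt] \displaystyle \frac{C}{n}\Big(\sigma^2(\log(en))^3\,n^{1-\alpha}+V\sigma(\log(en))^{3/2}\,n^{1-\alpha}\Big) & \text{if } \frac13\le\alpha<1. \end{cases} $$ Here $\|\cdot\|$ is the Euclidean norm over all vertices of the tree. -/

import Mathlib

open MeasureTheory ProbabilityTheory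
open scoped NNReal ENNReal

/-- A rooted tree on the vertex set `ι`, given by its parent map: the root is (by convention) its
own parent, and iterating the parent map leads from every vertex to the root. -/
structure ParentTree (ι : Type*) where
  root : ι
  parent : ι → ι
  parent_root : parent root = root
  reaches_root : ∀ v, ∃ k : ℕ, parent^[k] v = root

namespace ParentTree

variable {ι : Type*} [Fintype ι] [DecidableEq ι] (T : ParentTree ι)

/-- The children of the vertex `i`. -/
def children (i : ι) : Finset ι :=
  Finset.univ.filter fun j => j ≠ T.root ∧ T.parent j = i

/-- The cone of flows on `T`: at each vertex the flow is at least the sum of the flows of the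
children (for a leaf this sum is `0`, so that flows are nonnegative). -/
def flows : Set (ι → ℝ) :=
  {μ | ∀ i, ∑ j ∈ T.children i, μ j ≤ μ i}

/-- `m` minimizes the sum of squares `∑ i, (y i - f i) ^ 2` over all flows `f`. -/
def IsLeastSquares (y m : ι → ℝ) : Prop :=
  m ∈ T.flows ∧ ∀ f ∈ T.flows, ∑ i, (y i - m i) ^ 2 ≤ ∑ i, (y i - f i) ^ 2

theorem isClosed_flows : IsClosed T.flows := by
  have h : T.flows = ⋂ i, {μ : ι → ℝ | ∑ j ∈ T.children i, μ j ≤ μ i} := by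
    ext μ
    simp [flows]
  rw [h]
  exact isClosed_iInter fun i => isClosed_le (by fun_prop) (by fun_prop)

theorem convex_flows : Convex ℝ T.flows := by
  intro x hx y hy a b ha hb _ i
  have h1 := mul_le_mul_of_nonneg_left (hx i) ha
  have h2 := mul_le_mul_of_nonneg_left (hy i) hb
  simp only [Pi.add_apply, Pi.smul_apply, smul_eq_mul, Finset.sum_add_distrib, ← Finset.mul_sum]
  linarith

theorem exists_isLeastSquares (y : ι → ℝ) : ∃ m, T.IsLeastSquares y m := by
  obtain ⟨v, hv, hm⟩ := ((isClosed_flows T).preimage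
      (EuclideanSpace.equiv ι ℝ).continuous).exists_infDist_eq_dist
    ⟨0, by simp [flows]⟩ (WithLp.toLp 2 y)
  refine ⟨v.ofLp, hv, fun f hf => ?_⟩
  have h1 : dist (WithLp.toLp 2 y) v ≤ dist (WithLp.toLp 2 y) (WithLp.toLp 2 f) := by
    rw [← hm]
    exact Metric.infDist_le_dist_of_mem hf
  rw [EuclideanSpace.dist_eq, EuclideanSpace.dist_eq,
    Real.sqrt_le_sqrt_iff (Finset.sum_nonneg fun i _ => sq_nonneg _)] at h1
  simpa [Real.dist_eq, sq_abs] using h1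

theorem IsLeastSquares.unique {y m m' : ι → ℝ} (h : T.IsLeastSquares y m)
    (h' : T.IsLeastSquares y m') : m = m' := by
  have hc : (1 / 2 : ℝ) • m + (1 / 2 : ℝ) • m' ∈ T.flows :=
    T.convex_flows h.1 h'.1 (by norm_num) (by norm_num) (by norm_num)
  have e1 := h.2 _ hc
  have e2 := h'.2 _ hc
  have e3 : ∑ i, (y i - ((1 / 2 : ℝ) • m + (1 / 2 : ℝ) • m') i) ^ 2
      = (1 / 2) * ∑ i, (y i - m i) ^ 2 + (1 / 2) * ∑ i, (y i - m' i) ^ 2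
        - (1 / 4) * ∑ i, (m i - m' i) ^ 2 := by
    simp only [Finset.mul_sum, ← Finset.sum_add_distrib, ← Finset.sum_sub_distrib]
    refine Finset.sum_congr rfl fun i _ => ?_
    simp only [Pi.add_apply, Pi.smul_apply, smul_eq_mul]
    ring
  have e4 : ∑ i, (m i - m' i) ^ 2 = 0 :=
    le_antisymm (by linarith) (Finset.sum_nonneg fun i _ => sq_nonneg _)
  rw [Finset.sum_eq_zero_iff_of_nonneg fun i _ => sq_nonneg _] at e4
  funext i
  have := pow_eq_zero_iff (two_ne_zero) |>.1 (e4 i (Finset.mem_univ i))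
  linarith

/-- The least squares estimate over the cone of flows, for the data `y`. -/
noncomputable def leastSquares (y : ι → ℝ) : ι → ℝ :=
  (T.exists_isLeastSquares y).choose

theorem isLeastSquares_leastSquares (y : ι → ℝ) : T.IsLeastSquares y (T.leastSquares y) :=
  (T.exists_isLeastSquares y).choose_spec

/-- The worst case, over the flows `μ` with root value at most `V`, of
`𝔼 (1/n) ‖μ̂ - μ‖²`, where `μ̂` is the least squares estimator based on `μ + ε` and the noise
variables `ε i` are independent with law `N(0, σ²)`. -/
noncomputable def worstCaseRisk (n : ℕ) (σ : ℝ≥0) (V : ℝ) : ℝ≥0∞ :=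
  ⨆ (μ : ι → ℝ) (_ : μ ∈ T.flows) (_ : μ T.root ≤ V),
    ∫⁻ ε, ENNReal.ofReal ((1 / (n : ℝ)) * ∑ i, (T.leastSquares (μ + ε) i - μ i) ^ 2)
      ∂(Measure.pi fun _ : ι => gaussianReal 0 (σ ^ 2))

end ParentTree

/-- The parent map of the tree consisting of a root `none` and of `m` disjoint paths with `l`
vertices each, the first vertex of each path being a child of the root;
`some (j, k)` is the vertex number `k` (from `0`) on the path number `j`. -/
def spiderParent (m l : ℕ) : Option (Fin m × Fin l) → Option (Fin m × Fin l)
  | none => none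
  | some (_, ⟨0, _⟩) => none
  | some (j, ⟨k + 1, h⟩) => some (j, ⟨k, Nat.lt_of_succ_lt h⟩)

/-- A root with `m` children, each of which is the starting point of a path of `l` vertices. -/
def spiderTree (m l : ℕ) : ParentTree (Option (Fin m × Fin l)) where
  root := none
  parent := spiderParent m l
  parent_root := rfl
  reaches_root := by
    rintro (_ | ⟨j, k, hk⟩)
    · exact ⟨0, rfl⟩
    · refine ⟨k + 1, ?_⟩
      induction k with
      | zero => rfl
      | succ k ih =>
        rw [Function.iterate_succ_apply]
        exact ih (Nat.lt_of_succ_lt hk)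

/-- The tree with parameters `α` and `n`: `⌈n ^ α⌉` paths of `⌈n ^ (1 - α)⌉` vertices below
the root. -/
noncomputable def deepTree (α : ℝ) (n : ℕ) :
    ParentTree (Option (Fin ⌈(n : ℝ) ^ α⌉₊ × Fin ⌈(n : ℝ) ^ (1 - α)⌉₊)) :=
  spiderTree ⌈(n : ℝ) ^ α⌉₊ ⌈(n : ℝ) ^ (1 - α)⌉₊

/-!
The squared error of the least squares estimate `f` is bounded, for every noise vector, by an
integrable function of the noise. For a flow `u`, convexity gives the oracle inequality
`‖f - μ‖² ≤ ‖u - μ‖² + (2⟨ε, f - u⟩ - ‖f - u‖²)`, and everything depends on the choice of `u` and on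
a bound for the quadratic functional `2⟨ε, h⟩ - ‖h‖²` over the cone in which `h = f - u` lies.

*Sharp constants on the monotone cone.* For nonincreasing nonnegative `h` of length `l`, a layer
cake decomposition (superlevel sets of `h` are initial segments) bounds the functional by
`monotoneEnergy`, an integral over `t > 0` of the maximal prefix sum of `ε - t`. Summed over the
cyclic rotations of a sequence, the increments of the maximal prefix sum caused by the last term
telescope to the positive part of the total (`sum_prefixMax_rotation`). Exchangeability then gives
`𝔼 monotoneEnergy = σ² (1 + 1/2 + ⋯ + 1/l) / 2` (`integral_monotoneEnergy_extendZero`). A block of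
length `l` without sign constraint costs twice as much.

*Thin trees, `α ≤ 1/3`.* Write `L = log (e n)` and `s³ = n V² / (σ² L)`. If `s` is not small, `u`
keeps the root value of `μ` and rounds `μ` on the path `j`, whose top value is `a j`, to a grid with
`k j` nonzero levels (`exists_bound_of_levels`), where `k j` is the integer part of
`(l (a j)² / (σ² L))^(1/3)`. The power mean inequality and `m l ≤ 2 n` turn the sum of the costs
into a multiple of `s L σ²` with a factor below `2`; the difference pays for the root. If `s` is small,
`u = 0` is used (`exists_bound_of_zero`). As `n ^ α` may be close to `1` while there are two paths,
there is no room for the root value as a free parameter. The root inequality moves a negative noise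
at the root to the first vertices of the paths, which saves `σ² / (2π)` per path, and
`log 2 + 1/π > 1` is what is needed.

*Bushy trees.* A flow with root value `r` is `r` times a convex combination of `0` and of indicators
of the root together with initial segments of one path. Hence `⟨ε, f⟩ ≤ r R`, with `R` the largest
noise sum over such a set, up to constants. Since the root value of `f` is at most `V + ‖f - μ‖`,
one gets `‖f - μ‖² ≤ 2 V R + R² - 2⟨ε, μ⟩`, and exponential moments bound `𝔼 R²` by a multiple of
`σ² l L²` (`exists_bound_of_prefixMax`).
-/

/-! ### Prefix maxima and the monotone cone -/

/-- The largest of the prefix sums `0, x 0, x 0 + x 1, …, x 0 + ⋯ + x (n - 1)`. -/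
noncomputable def prefixMax : ℕ → (ℕ → ℝ) → ℝ
  | 0, _ => 0
  | n + 1, x => max 0 (x 0 + prefixMax n fun i => x (i + 1))

theorem prefixMax_nonneg (n : ℕ) (x : ℕ → ℝ) : 0 ≤ prefixMax n x := by
  cases n with
  | zero => exact le_rfl
  | succ n => exact le_max_left _ _

theorem prefixMax_congr {n : ℕ} {x y : ℕ → ℝ} (h : ∀ i < n, x i = y i) :
    prefixMax n x = prefixMax n y := by
  induction n generalizing x y with
  | zero => rfl
  | succ n ih =>
    rw [prefixMax, prefixMax, h 0 n.succ_pos, ih fun i hi => h (i + 1) (by omega)]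

/-- The recursion at the last term, while the definition recurses at the first one. -/
theorem prefixMax_succ' (n : ℕ) (x : ℕ → ℝ) :
    prefixMax (n + 1) x = max (prefixMax n x) (∑ i ∈ Finset.range (n + 1), x i) := by
  induction n generalizing x with
  | zero => simp [prefixMax]
  | succ n ih =>
    rw [prefixMax, ih, Finset.sum_range_succ' _ (n + 1), prefixMax, max_assoc, add_comm _ (x 0),
      max_add_add_left]

theorem sum_le_prefixMax (n : ℕ) (x : ℕ → ℝ) : ∑ i ∈ Finset.range n, x i ≤ prefixMax n x := by
  cases n with
  | zero => simp [prefixMax]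
  | succ n => rw [prefixMax_succ']; exact le_max_right _ _

theorem prefixMax_le_sum (n : ℕ) (x : ℕ → ℝ) :
    prefixMax n x ≤ ∑ i ∈ Finset.range n, max 0 (x i) := by
  induction n generalizing x with
  | zero => simp [prefixMax]
  | succ n ih =>
    rw [prefixMax, Finset.sum_range_succ']
    refine max_le (by positivity) ?_
    have := ih fun i => x (i + 1)
    have := le_max_right 0 (x 0)
    linarith

theorem measurable_prefixMax (n : ℕ) : Measurable (prefixMax n) := by
  induction n with
  | zero => exact measurable_const
  | succ n ih =>
    refine measurable_const.max ((measurable_pi_apply 0).add (ih.comp ?_))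
    exact measurable_pi_lambda _ fun i => measurable_pi_apply (i + 1)

/-- Over the `n` cyclic rotations of a sequence of length `n`, the increments of the prefix
maximum caused by the last term add up to the positive part of the total. -/
theorem sum_prefixMax_rotation (n : ℕ) (x : ℕ → ℝ) (hx : ∀ i, x (i + (n + 1)) = x i) :
    ∑ r ∈ Finset.range (n + 1),
        (prefixMax (n + 1) (fun i => x (r + i)) - prefixMax n fun i => x (r + i))
      = max 0 (∑ i ∈ Finset.range (n + 1), x i) := by
  set S := ∑ i ∈ Finset.range (n + 1), x i with hS
  have hrot : ∀ r, ∑ i ∈ Finset.range (n + 1), x (r + i) = S := by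
    intro r
    induction r with
    | zero => simp [hS]
    | succ r ih =>
      rw [← ih, Finset.sum_range_succ, Finset.sum_range_succ']
      congr 1
      · exact Finset.sum_congr rfl fun i _ => by congr 1; ring
      · rw [← hx (r + 0)]; congr 1; ring
  -- If `S ≤ 0` the full sum never beats the empty one. If `S > 0` the empty sum never is the
  -- maximum, so the first term splits off and the differences telescope.
  rcases le_or_gt S 0 with h | h
  · rw [max_eq_left h]
    refine Finset.sum_eq_zero fun r _ => ?_
    rw [prefixMax_succ', hrot, max_eq_left (h.trans (prefixMax_nonneg _ _)), sub_self]
  · have key : ∀ r, prefixMax (n + 1) (fun i => x (r + i))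
        = x r + prefixMax n fun i => x (r + 1 + i) := by
      intro r
      have h1 := sum_le_prefixMax n fun i => x (r + 1 + i)
      have h2 := hrot r
      rw [Finset.sum_range_succ'] at h2
      have h3 : ∀ i, x (r + (i + 1)) = x (r + 1 + i) := fun i => by congr 1; ring
      simp only [h3, add_zero] at h2
      rw [prefixMax]
      simp only [h3, add_zero]
      exact max_eq_right (by linarith)
    rw [max_eq_right h.le]
    have tel := Finset.sum_range_succ (fun r => prefixMax n fun i => x (r + i)) (n + 1)
    rw [Finset.sum_range_succ'] at tel
    have hper : (prefixMax n fun i => x (n + 1 + i)) = prefixMax n fun i => x (0 + i) := by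
      congr 1; funext i; rw [← hx (0 + i)]; congr 1; ring
    rw [hper] at tel
    simp only [key, Finset.sum_sub_distrib, Finset.sum_add_distrib]
    linarith

theorem integrableOn_posPart_sub_mul {a : ℝ} (ha : 0 < a) (y : ℝ) :
    IntegrableOn (fun t => max 0 (y - a * t)) (Set.Ioi 0) := by
  have h : IntegrableOn (fun t => max 0 (y - a * t)) (Set.Ioc 0 (max 0 (y / a))) :=
    (Continuous.integrableOn_Icc (by fun_prop)).mono_set Set.Ioc_subset_Icc_self
  refine h.of_forall_sdiff_eq_zero measurableSet_Ioi fun t ht => ?_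
  have h1 : 0 < t := ht.1
  have h2 : max 0 (y / a) < t := by
    by_contra hc
    exact ht.2 ⟨h1, not_lt.1 hc⟩
  have h3 : y / a < t := (le_max_right _ _).trans_lt h2
  rw [div_lt_iff₀ ha] at h3
  exact max_eq_left (by linarith)

theorem integral_posPart_sub_mul {a : ℝ} (ha : 0 < a) (y : ℝ) :
    2 * ∫ t in Set.Ioi (0 : ℝ), max 0 (y - a * t) = (max 0 y) ^ 2 / a := by
  have hb : (0 : ℝ) ≤ max 0 (y / a) := le_max_left _ _
  have h : ∫ t in Set.Ioi (0 : ℝ), max 0 (y - a * t)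
      = ∫ t in Set.Ioc 0 (max 0 (y / a)), (max 0 y - a * t) := by
    rw [setIntegral_eq_of_subset_of_forall_sdiff_eq_zero measurableSet_Ioi
      (s := Set.Ioc 0 (max 0 (y / a))) (fun t ht => ht.1)]
    · refine setIntegral_congr_fun measurableSet_Ioc fun t ht => ?_
      rcases le_or_gt y 0 with hy | hy
      · rw [max_eq_left (div_nonpos_of_nonpos_of_nonneg hy ha.le)] at ht
        exact absurd ht.1 (not_lt.2 ht.2)
      · have h2 := ht.2
        rw [max_eq_right (div_pos hy ha).le, le_div_iff₀ ha] at h2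
        simp only [max_eq_right hy.le]
        exact max_eq_right (by linarith)
    · intro t ht
      have h1 : 0 < t := ht.1
      have h2 : max 0 (y / a) < t := by
        by_contra hc
        exact ht.2 ⟨h1, not_lt.1 hc⟩
      have h3 : y / a < t := (le_max_right _ _).trans_lt h2
      rw [div_lt_iff₀ ha] at h3
      exact max_eq_left (by linarith)
  rw [h, ← intervalIntegral.integral_of_le hb, intervalIntegral.integral_sub (by simp)
    (by apply Continuous.intervalIntegrable; fun_prop), intervalIntegral.integral_const,
    intervalIntegral.integral_const_mul, integral_id]
  rcases le_or_gt y 0 with hy | hy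
  · rw [max_eq_left hy, max_eq_left (div_nonpos_of_nonpos_of_nonneg hy ha.le)]; simp
  · rw [max_eq_right hy.le, max_eq_right (div_pos hy ha).le]
    simp only [smul_eq_mul]
    field_simp
    ring

theorem measurable_prefixMax_sub (n : ℕ) :
    Measurable fun p : (ℕ → ℝ) × ℝ => prefixMax n fun i => p.1 i - p.2 :=
  (measurable_prefixMax n).comp (measurable_pi_lambda _ fun i =>
    ((measurable_pi_apply i).comp measurable_fst).sub measurable_snd)

theorem integrableOn_prefixMax (n : ℕ) (x : ℕ → ℝ) :
    IntegrableOn (fun t => prefixMax n fun i => x i - t) (Set.Ioi 0) := by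
  have h : IntegrableOn (fun t => ∑ i ∈ Finset.range n, max 0 (x i - t)) (Set.Ioi 0) := by
    refine integrable_finsetSum _ fun i _ => ?_
    have := integrableOn_posPart_sub_mul one_pos (x i)
    rwa [show (fun t => max 0 (x i - 1 * t)) = fun t => max 0 (x i - t) by simp] at this
  refine Integrable.mono' h ?_ ?_
  · exact ((measurable_prefixMax_sub n).comp
      (measurable_const.prodMk measurable_id)).aestronglyMeasurable
  · refine Filter.Eventually.of_forall fun t => ?_
    rw [Real.norm_of_nonneg (prefixMax_nonneg _ _)]
    exact prefixMax_le_sum _ _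

/-- Twice the integral over `t > 0` of the prefix maxima of the sequences `x - t`. This is the
squared norm of the projection of `(x 0, …, x (n - 1))` onto the cone of nonincreasing nonnegative
sequences, of which only the upper bound `quadratic_le_monotoneEnergy` is needed. -/
noncomputable def monotoneEnergy (n : ℕ) (x : ℕ → ℝ) : ℝ :=
  2 * ∫ t in Set.Ioi (0 : ℝ), prefixMax n fun i => x i - t

theorem monotoneEnergy_nonneg (n : ℕ) (x : ℕ → ℝ) : 0 ≤ monotoneEnergy n x :=
  mul_nonneg zero_le_two (integral_nonneg fun _ => prefixMax_nonneg _ _)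

theorem monotoneEnergy_congr {n : ℕ} {x y : ℕ → ℝ} (h : ∀ i < n, x i = y i) :
    monotoneEnergy n x = monotoneEnergy n y := by
  unfold monotoneEnergy
  congr 2
  funext t
  exact prefixMax_congr fun i hi => by rw [h i hi]

theorem monotoneEnergy_le_sum (n : ℕ) (x : ℕ → ℝ) :
    monotoneEnergy n x ≤ ∑ i ∈ Finset.range n, x i ^ 2 := by
  have hi : ∀ i ∈ Finset.range n, IntegrableOn (fun t => max 0 (x i - t)) (Set.Ioi 0) :=
    fun i _ => by simpa using integrableOn_posPart_sub_mul one_pos (x i)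
  calc monotoneEnergy n x ≤ 2 * ∫ t in Set.Ioi (0 : ℝ), ∑ i ∈ Finset.range n, max 0 (x i - t) :=
        mul_le_mul_of_nonneg_left (integral_mono (integrableOn_prefixMax n x)
          (integrable_finsetSum _ hi) fun t => prefixMax_le_sum _ _) zero_le_two
    _ = ∑ i ∈ Finset.range n, (max 0 (x i)) ^ 2 := by
        rw [integral_finsetSum _ hi, Finset.mul_sum]
        refine Finset.sum_congr rfl fun i _ => ?_
        simpa using integral_posPart_sub_mul one_pos (x i)
    _ ≤ _ := by
        refine Finset.sum_le_sum fun i _ => ?_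
        rcases le_total (x i) 0 with h | h
        · rw [max_eq_left h, zero_pow two_ne_zero]; exact sq_nonneg _
        · rw [max_eq_right h]

theorem measurable_monotoneEnergy (n : ℕ) : Measurable (monotoneEnergy n) := by
  have h : StronglyMeasurable fun x : ℕ → ℝ =>
      ∫ t in Set.Ioi (0 : ℝ), prefixMax n fun i => x i - t :=
    (measurable_prefixMax_sub n).stronglyMeasurable.integral_prod_right'
  exact h.measurable.const_mul 2

/-- The rotation identity for prefix maxima, integrated over `t`. -/
theorem sum_monotoneEnergy_rotation (n : ℕ) (x : ℕ → ℝ) (hx : ∀ i, x (i + (n + 1)) = x i) :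
    ∑ r ∈ Finset.range (n + 1),
        (monotoneEnergy (n + 1) (fun i => x (r + i)) - monotoneEnergy n fun i => x (r + i))
      = (max 0 (∑ i ∈ Finset.range (n + 1), x i)) ^ 2 / (n + 1) := by
  have hn : (0 : ℝ) < n + 1 := by positivity
  rw [← integral_posPart_sub_mul hn]
  have h : ∀ t : ℝ, max 0 (∑ i ∈ Finset.range (n + 1), x i - (n + 1) * t)
      = ∑ r ∈ Finset.range (n + 1), ((prefixMax (n + 1) fun i => x (r + i) - t)
        - prefixMax n fun i => x (r + i) - t) := by
    intro t
    rw [sum_prefixMax_rotation n (fun i => x i - t) fun i => by rw [hx]]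
    simp [Finset.sum_sub_distrib]
  simp_rw [h]
  rw [integral_finsetSum, Finset.mul_sum]
  · refine Finset.sum_congr rfl fun r _ => ?_
    rw [integral_sub (integrableOn_prefixMax _ fun i => x (r + i))
      (integrableOn_prefixMax _ fun i => x (r + i)), mul_sub]
    rfl
  · exact fun r _ => (integrableOn_prefixMax _ fun i => x (r + i)).sub
      (integrableOn_prefixMax _ fun i => x (r + i))

/-- Every superlevel set of a nonincreasing sequence is an initial segment. -/
theorem sum_superlevel_le_prefixMax (n : ℕ) (x h : ℕ → ℝ) (t : ℝ)
    (hh : ∀ i j, i ≤ j → j < n → h j ≤ h i) :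
    ∑ i ∈ Finset.range n, (if t < h i then x i else 0) ≤ prefixMax n x := by
  induction n generalizing x h with
  | zero => simp [prefixMax]
  | succ n ih =>
    rw [Finset.sum_range_succ', prefixMax]
    by_cases h0 : t < h 0
    · rw [if_pos h0]
      have := ih (fun i => x (i + 1)) (fun i => h (i + 1)) fun i j hij hj =>
        hh _ _ (by omega) (by omega)
      exact le_max_of_le_right (by linarith)
    · rw [if_neg h0, Finset.sum_eq_zero, add_zero]
      · exact le_max_left _ _
      · intro i hi
        rw [if_neg]
        exact fun h' => h0 (h'.trans_le (hh 0 (i + 1) (by omega)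
          (by have := Finset.mem_range.1 hi; omega)))

/-- Layer cake formula for the function `2 x h - h²` of `h ≥ 0`. -/
theorem layer_cake_quadratic (x : ℝ) {h : ℝ} (hh : 0 ≤ h) :
    IntegrableOn (fun t => if t < h then x - t else 0) (Set.Ioi 0) ∧
    2 * ∫ t in Set.Ioi (0 : ℝ), (if t < h then x - t else 0) = 2 * x * h - h ^ 2 := by
  have e : ∀ t ∈ Set.Ioi (0 : ℝ),
      (if t < h then x - t else 0) = (Set.Ioo 0 h).indicator (fun t => x - t) t := by
    intro t ht
    by_cases h1 : t < h
    · rw [if_pos h1, Set.indicator_of_mem (show t ∈ Set.Ioo 0 h from ⟨ht, h1⟩)]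
    · rw [if_neg h1, Set.indicator_of_notMem fun h2 => h1 h2.2]
  have hI : IntegrableOn (fun t => x - t) (Set.Ioo 0 h) :=
    (Continuous.integrableOn_Icc (by fun_prop)).mono_set Set.Ioo_subset_Icc_self
  constructor
  · rw [integrableOn_congr_fun e measurableSet_Ioi]
    exact ((integrable_indicator_iff measurableSet_Ioo).2 hI).integrableOn
  · rw [setIntegral_congr_fun measurableSet_Ioi e, setIntegral_indicator measurableSet_Ioo,
      Set.inter_eq_right.2 fun t ht => ht.1, ← integral_Ioc_eq_integral_Ioo,
      ← intervalIntegral.integral_of_le hh, intervalIntegral.integral_sub (by simp) (by simp),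
      intervalIntegral.integral_const, integral_id, smul_eq_mul]
    ring

/-- The support function bound: `monotoneEnergy n x` dominates the quadratic functional
`2⟨x, h⟩ - ‖h‖²` on the cone of nonincreasing nonnegative sequences. -/
theorem quadratic_le_monotoneEnergy (n : ℕ) (x h : ℕ → ℝ)
    (hh : ∀ i j, i ≤ j → j < n → h j ≤ h i) (h0 : ∀ i < n, 0 ≤ h i) :
    ∑ i ∈ Finset.range n, (2 * x i * h i - h i ^ 2) ≤ monotoneEnergy n x := by
  have hI : ∀ i ∈ Finset.range n,
      IntegrableOn (fun t => if t < h i then x i - t else 0) (Set.Ioi 0) :=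
    fun i hi => (layer_cake_quadratic (x i) (h0 i (Finset.mem_range.1 hi))).1
  rw [Finset.sum_congr rfl fun i hi =>
    ((layer_cake_quadratic (x i) (h0 i (Finset.mem_range.1 hi))).2).symm,
    ← Finset.mul_sum, ← integral_finsetSum _ hI]
  exact mul_le_mul_of_nonneg_left (integral_mono (integrable_finsetSum _ hI)
    (integrableOn_prefixMax n x) fun t => sum_superlevel_le_prefixMax n _ h t hh) zero_le_two

/-- Lowering the first term by `c ≥ 0` lowers the energy at least as much as it lowers the energy
of the one-term sequence. -/
theorem monotoneEnergy_sub_first (n : ℕ) (x y : ℕ → ℝ) {c : ℝ} (hc : 0 ≤ c)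
    (hy0 : y 0 = x 0 - c) (hy : ∀ i, y (i + 1) = x (i + 1)) :
    monotoneEnergy (n + 1) y
      ≤ monotoneEnergy (n + 1) x + (max 0 (x 0 - c)) ^ 2 - (max 0 (x 0)) ^ 2 := by
  have h1 := integral_posPart_sub_mul one_pos (x 0 - c)
  have h2 := integral_posPart_sub_mul one_pos (x 0)
  have i1 := integrableOn_posPart_sub_mul one_pos (x 0 - c)
  have i2 := integrableOn_posPart_sub_mul one_pos (x 0)
  simp only [one_mul, div_one] at h1 h2 i1 i2
  have i3 := integrableOn_prefixMax (n + 1) x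
  have i4 := integrableOn_prefixMax (n + 1) y
  rw [← h1, ← h2, monotoneEnergy, monotoneEnergy]
  have key : ∫ t in Set.Ioi (0 : ℝ), ((prefixMax (n + 1) fun i => y i - t) + max 0 (x 0 - t))
      ≤ ∫ t in Set.Ioi (0 : ℝ), ((prefixMax (n + 1) fun i => x i - t) + max 0 (x 0 - c - t)) := by
    refine integral_mono (i4.add i2) (i3.add i1) fun t => ?_
    simp only [prefixMax, hy0, hy]
    have := prefixMax_nonneg n fun i => x (i + 1) - t
    -- `y ↦ (y - c)₊ - y₊` is nonincreasing, and is compared at `y` and at `y + N`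
    generalize prefixMax n (fun i => x (i + 1) - t) = N at *
    rcases max_cases 0 (x 0 - c - t + N) with ⟨e1, _⟩ | ⟨e1, _⟩ <;>
    rcases max_cases 0 (x 0 - t) with ⟨e2, _⟩ | ⟨e2, _⟩ <;>
    rcases max_cases 0 (x 0 - t + N) with ⟨e3, _⟩ | ⟨e3, _⟩ <;>
    rcases max_cases 0 (x 0 - c - t) with ⟨e4, _⟩ | ⟨e4, _⟩ <;>
    rw [e1, e2, e3, e4] <;> linarith
  rw [integral_add i4 i2, integral_add i3 i1] at key
  linarith

/-! ### Gaussian expectations -/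

/-- The joint law of independent centred Gaussian variables of variance `v`, indexed by `ι`. -/
noncomputable abbrev iidGaussian (ι : Type*) [Fintype ι] (v : ℝ≥0) : Measure (ι → ℝ) :=
  Measure.pi fun _ : ι => gaussianReal 0 v

theorem measurePreserving_iidGaussian_comp {ι κ : Type*} [Fintype ι] [Fintype κ] (v : ℝ≥0)
    {e : κ → ι} (he : Function.Injective e) :
    MeasurePreserving (fun (ε : ι → ℝ) k => ε (e k)) (iidGaussian ι v) (iidGaussian κ v) := by
  have h1 : iIndepFun (fun (i : ι) (ε : ι → ℝ) => ε i) (iidGaussian ι v) :=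
    iIndepFun_pi (X := fun _ x => x) fun i => aemeasurable_id
  have h2 := h1.precomp he
  refine ⟨by fun_prop, ?_⟩
  have h3 := (iIndepFun_iff_map_fun_eq_pi_map
    fun i => (measurable_pi_apply (e i)).aemeasurable).1 h2
  refine h3.trans ?_
  congr 1
  funext k
  exact (measurePreserving_eval (fun _ : ι => gaussianReal 0 v) (e k)).map_eq

theorem integral_comp_of_measurePreserving {α β : Type*} [MeasurableSpace α] [MeasurableSpace β]
    {P : Measure α} {Q : Measure β} {T : α → β} (hT : MeasurePreserving T P Q) {f : β → ℝ}
    (hf : Measurable f) : ∫ x, f (T x) ∂P = ∫ y, f y ∂Q := by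
  rw [← hT.map_eq, integral_map hT.measurable.aemeasurable hf.aestronglyMeasurable]

theorem measurePreserving_iidGaussian_neg {ι : Type*} [Fintype ι] (v : ℝ≥0) :
    MeasurePreserving (fun (ε : ι → ℝ) => -ε) (iidGaussian ι v) (iidGaussian ι v) := by
  refine ⟨by fun_prop, ?_⟩
  have h := Measure.pi_map_pi (μ := fun _ : ι => gaussianReal 0 v) (f := fun _ (x : ℝ) => -x)
    fun i => by fun_prop
  simp only [gaussianReal_map_neg, neg_zero] at h
  exact h

theorem measurePreserving_iidGaussian_eval {ι : Type*} [Fintype ι] (v : ℝ≥0) (i : ι) :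
    MeasurePreserving (fun ε : ι → ℝ => ε i) (iidGaussian ι v) (gaussianReal 0 v) :=
  measurePreserving_eval (fun _ : ι => gaussianReal 0 v) i

theorem measurePreserving_iidGaussian_pair {ι : Type*} [Fintype ι] (v : ℝ≥0) {i j : ι}
    (hij : i ≠ j) :
    MeasurePreserving (fun ε : ι → ℝ => (ε i, ε j)) (iidGaussian ι v)
      ((gaussianReal 0 v).prod (gaussianReal 0 v)) := by
  have h1 : iIndepFun (fun (i : ι) (ε : ι → ℝ) => ε i) (iidGaussian ι v) :=
    iIndepFun_pi (X := fun _ x => x) fun i => aemeasurable_id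
  have h2 := (indepFun_iff_map_prod_eq_prod_map_map (measurable_pi_apply i).aemeasurable
    (measurable_pi_apply j).aemeasurable).1 (h1.indepFun hij)
  refine ⟨by fun_prop, h2.trans ?_⟩
  rw [(measurePreserving_iidGaussian_eval v i).map_eq,
    (measurePreserving_iidGaussian_eval v j).map_eq]

theorem integrable_sq_gaussianReal (v : ℝ≥0) : Integrable (fun x => x ^ 2) (gaussianReal 0 v) :=
  (memLp_id_gaussianReal 2).integrable_sq

theorem integral_sq_gaussianReal (v : ℝ≥0) : ∫ x, x ^ 2 ∂gaussianReal 0 v = v := by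
  have h := variance_of_integral_eq_zero (X := fun x : ℝ => x) (μ := gaussianReal 0 v)
    aemeasurable_id' integral_id_gaussianReal
  rw [← h, variance_fun_id_gaussianReal]

theorem integrable_eval_sq {ι : Type*} [Fintype ι] (v : ℝ≥0) (i : ι) :
    Integrable (fun ε : ι → ℝ => ε i ^ 2) (iidGaussian ι v) :=
  (measurePreserving_iidGaussian_eval v i).integrable_comp_of_integrable
    (integrable_sq_gaussianReal v)

theorem integral_eval_sq {ι : Type*} [Fintype ι] (v : ℝ≥0) (i : ι) :
    ∫ ε : ι → ℝ, ε i ^ 2 ∂iidGaussian ι v = v := by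
  rw [← integral_sq_gaussianReal v]
  exact integral_comp_of_measurePreserving (measurePreserving_iidGaussian_eval v i)
    (measurable_id.pow_const 2)

theorem integrable_iidGaussian_eval {ι : Type*} [Fintype ι] (v : ℝ≥0) (i : ι) :
    Integrable (fun ε : ι → ℝ => ε i) (iidGaussian ι v) :=
  (measurePreserving_iidGaussian_eval v i).integrable_comp_of_integrable
    ((memLp_id_gaussianReal 1).integrable le_rfl)

theorem integral_iidGaussian_eval {ι : Type*} [Fintype ι] (v : ℝ≥0) (i : ι) :
    ∫ ε : ι → ℝ, ε i ∂iidGaussian ι v = 0 := by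
  conv_rhs => rw [← integral_id_gaussianReal (μ := 0) (v := v)]
  exact integral_comp_of_measurePreserving (measurePreserving_iidGaussian_eval v i) measurable_id

theorem sq_max_zero_le (a : ℝ) : (max 0 a) ^ 2 ≤ a ^ 2 := by
  rcases le_total a 0 with h | h
  · rw [max_eq_left h, zero_pow two_ne_zero]; exact sq_nonneg _
  · rw [max_eq_right h]

theorem sq_max_zero_add (a : ℝ) : (max 0 a) ^ 2 + (max 0 (-a)) ^ 2 = a ^ 2 := by
  rcases le_total a 0 with h | h
  · rw [max_eq_left h, max_eq_right (by linarith)]; ring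
  · rw [max_eq_right h, max_eq_left (by linarith)]; ring

theorem integrable_sq_max_zero {Ω : Type*} [MeasurableSpace Ω] {P : Measure Ω} {f : Ω → ℝ}
    (hf : Measurable f) (h : Integrable (fun ω => f ω ^ 2) P) :
    Integrable (fun ω => (max 0 (f ω)) ^ 2) P :=
  h.mono' ((measurable_const.max hf).pow_const 2).aestronglyMeasurable
    (Filter.Eventually.of_forall fun ω => by
      rw [Real.norm_of_nonneg (sq_nonneg _)]; exact sq_max_zero_le _)

/-- An odd function of a symmetric Gaussian vector puts half of its second moment on its positive
part. -/
theorem integral_sq_max_zero_of_odd {ι : Type*} [Fintype ι] (v : ℝ≥0) {f : (ι → ℝ) → ℝ}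
    (hf : Measurable f) (hodd : ∀ ε, f (-ε) = -f ε)
    (h : Integrable (fun ε => f ε ^ 2) (iidGaussian ι v)) :
    ∫ ε, (max 0 (f ε)) ^ 2 ∂iidGaussian ι v = (∫ ε, f ε ^ 2 ∂iidGaussian ι v) / 2 := by
  have h1 : ∫ ε, (max 0 (-f ε)) ^ 2 ∂iidGaussian ι v = ∫ ε, (max 0 (f ε)) ^ 2 ∂iidGaussian ι v := by
    rw [← integral_comp_of_measurePreserving (measurePreserving_iidGaussian_neg v)
      ((measurable_const.max hf).pow_const 2)]
    simp only [hodd]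
  have h2 : Integrable (fun ε => (max 0 (-f ε)) ^ 2) (iidGaussian ι v) :=
    integrable_sq_max_zero hf.neg (by simpa using h)
  have h3 := integral_add (integrable_sq_max_zero hf h) h2
  simp only [sq_max_zero_add] at h3
  linarith

theorem integral_sq_eval_max_zero {ι : Type*} [Fintype ι] (v : ℝ≥0) (i : ι) :
    ∫ ε : ι → ℝ, (max 0 (ε i)) ^ 2 ∂iidGaussian ι v = v / 2 := by
  rw [integral_sq_max_zero_of_odd v (measurable_pi_apply i) (fun _ => rfl)
    (integrable_eval_sq v i), integral_eval_sq]

theorem integrable_sq_sum {n : ℕ} (v : ℝ≥0) :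
    Integrable (fun ε : Fin n → ℝ => (∑ i, ε i) ^ 2) (iidGaussian (Fin n) v) := by
  have h : MemLp (fun ε : Fin n → ℝ => ∑ i, ε i) 2 (iidGaussian (Fin n) v) :=
    memLp_finsetSum _ fun i _ => (memLp_id_gaussianReal 2).comp_measurePreserving
      (measurePreserving_iidGaussian_eval v i)
  exact h.integrable_sq

theorem integral_sq_sum (n : ℕ) (v : ℝ≥0) :
    ∫ ε : Fin n → ℝ, (∑ i, ε i) ^ 2 ∂iidGaussian (Fin n) v = n * v := by
  have h := variance_sum_pi (μ := fun _ : Fin n => gaussianReal 0 v) (X := fun _ x => x)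
    fun i => memLp_id_gaussianReal 2
  rw [variance_of_integral_eq_zero (by fun_prop)] at h
  · simpa using h
  · simp only [Finset.sum_apply]
    rw [integral_finsetSum _ fun i _ => integrable_iidGaussian_eval v i]
    simp [integral_iidGaussian_eval]

/-- Extension of a finite sequence by zero. -/
def extendZero {n : ℕ} (x : Fin n → ℝ) (i : ℕ) : ℝ := if h : i < n then x ⟨i, h⟩ else 0

theorem measurable_extendZero (n : ℕ) : Measurable (extendZero (n := n)) := by
  refine measurable_pi_lambda _ fun i => ?_
  unfold extendZero
  split_ifs
  · exact measurable_pi_apply _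
  · exact measurable_const

theorem integrable_monotoneEnergy {ι : Type*} [Fintype ι] (v : ℝ≥0) (n : ℕ) {f : (ι → ℝ) → ℕ → ℝ}
    (hf : Measurable f) (h : ∀ i < n, Integrable (fun ε => f ε i ^ 2) (iidGaussian ι v)) :
    Integrable (fun ε => monotoneEnergy n (f ε)) (iidGaussian ι v) :=
  (integrable_finsetSum (Finset.range n) fun i hi => h i (Finset.mem_range.1 hi)).mono'
    ((measurable_monotoneEnergy n).comp hf).aestronglyMeasurable
    (Filter.Eventually.of_forall fun ε => by
      rw [Real.norm_of_nonneg (monotoneEnergy_nonneg _ _)]; exact monotoneEnergy_le_sum _ _)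

theorem integrable_monotoneEnergy_comp {ι : Type*} [Fintype ι] (v : ℝ≥0) (n : ℕ) (e : ℕ → ι) :
    Integrable (fun ε => monotoneEnergy n fun i => ε (e i)) (iidGaussian ι v) :=
  integrable_monotoneEnergy v n (by fun_prop) fun i _ => integrable_eval_sq v (e i)

theorem integral_monotoneEnergy_comp_eq {ι : Type*} [Fintype ι] (v : ℝ≥0) (n : ℕ) (e : ℕ → ι)
    (he : Set.InjOn e (Set.Iio n)) :
    ∫ ε, monotoneEnergy n (fun i => ε (e i)) ∂iidGaussian ι v
      = ∫ y, monotoneEnergy n (extendZero y) ∂iidGaussian (Fin n) v := by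
  have hinj : Function.Injective fun k : Fin n => e k := fun a b hab =>
    Fin.ext (he a.2 b.2 hab)
  refine Eq.trans ?_ (integral_comp_of_measurePreserving (measurePreserving_iidGaussian_comp v hinj)
    ((measurable_monotoneEnergy n).comp (measurable_extendZero n)))
  refine integral_congr_ae (Filter.Eventually.of_forall fun ε => ?_)
  exact monotoneEnergy_congr fun i hi => by simp [extendZero, hi]

/-- Exchangeability and the rotation identity give the expected energy as a harmonic number. -/
theorem integral_monotoneEnergy_extendZero (v : ℝ≥0) (n : ℕ) :
    ∫ y, monotoneEnergy n (extendZero y) ∂iidGaussian (Fin n) v = v * (harmonic n : ℝ) / 2 := by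
  induction n with
  | zero => simp [monotoneEnergy, prefixMax]
  | succ n ih =>
    -- `e (r + ·)` lists the indices cyclically from `r` on
    set e : ℕ → Fin (n + 1) := fun i => ⟨i % (n + 1), Nat.mod_lt _ n.succ_pos⟩ with he
    have hinj : ∀ r, Set.InjOn (fun i => e (r + i)) (Set.Iio (n + 1)) := by
      intro r a ha b hb hab
      have h1 : (r + a) % (n + 1) = (r + b) % (n + 1) := congrArg Fin.val hab
      have h2 : a ≡ b [MOD n + 1] := Nat.ModEq.add_left_cancel' r h1
      exact Nat.ModEq.eq_of_lt_of_lt h2 ha hb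
    have hrot : ∀ ε : Fin (n + 1) → ℝ, ∑ r ∈ Finset.range (n + 1),
        (monotoneEnergy (n + 1) (fun i => ε (e (r + i))) - monotoneEnergy n fun i => ε (e (r + i)))
        = (max 0 (∑ i, ε i)) ^ 2 / (n + 1) := by
      intro ε
      rw [sum_monotoneEnergy_rotation n (fun i => ε (e i)) fun i => by simp [he],
        Finset.sum_range]
      congr 4
      funext i
      congr 1
      exact Fin.ext (Nat.mod_eq_of_lt i.2)
    have hint := congrArg (fun f => ∫ ε, f ε ∂iidGaussian (Fin (n + 1)) v) (funext hrot)
    have hI1 := fun r => integrable_monotoneEnergy_comp v (n + 1) fun i => e (r + i)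
    have hI2 := fun r => integrable_monotoneEnergy_comp v n fun i => e (r + i)
    have hI3 : ∀ r, Integrable (fun ε => monotoneEnergy (n + 1) (fun i => ε (e (r + i)))
        - monotoneEnergy n fun i => ε (e (r + i))) (iidGaussian (Fin (n + 1)) v) :=
      fun r => (hI1 r).sub (hI2 r)
    have hsum : Measurable fun ε : Fin (n + 1) → ℝ => ∑ i, ε i := by fun_prop
    simp only at hint
    rw [integral_finsetSum _ fun r _ => hI3 r, integral_div,
      integral_sq_max_zero_of_odd v hsum (fun ε => by simp) (integrable_sq_sum v),
      integral_sq_sum] at hint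
    have hterm : ∀ r, ∫ ε, (monotoneEnergy (n + 1) (fun i => ε (e (r + i)))
        - monotoneEnergy n fun i => ε (e (r + i))) ∂iidGaussian (Fin (n + 1)) v
        = ∫ y, monotoneEnergy (n + 1) (extendZero y) ∂iidGaussian (Fin (n + 1)) v
          - v * (harmonic n : ℝ) / 2 := by
      intro r
      rw [integral_sub (hI1 r) (hI2 r), integral_monotoneEnergy_comp_eq v (n + 1) _ (hinj r),
        integral_monotoneEnergy_comp_eq v n _ ((hinj r).mono (Set.Iio_subset_Iio n.le_succ)), ih]
    simp only [hterm, Finset.sum_const, Finset.card_range, nsmul_eq_mul] at hint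
    rw [harmonic_succ]
    push_cast at hint ⊢
    have hn : (n : ℝ) + 1 ≠ 0 := by positivity
    field_simp at hint ⊢
    linarith

theorem integral_monotoneEnergy_comp {ι : Type*} [Fintype ι] (v : ℝ≥0) (n : ℕ) (e : ℕ → ι)
    (he : Set.InjOn e (Set.Iio n)) :
    ∫ ε, monotoneEnergy n (fun i => ε (e i)) ∂iidGaussian ι v = v * (harmonic n : ℝ) / 2 := by
  rw [integral_monotoneEnergy_comp_eq v n e he, integral_monotoneEnergy_extendZero]

theorem integrable_monotoneEnergy_neg_comp {ι : Type*} [Fintype ι] (v : ℝ≥0) (n : ℕ) (e : ℕ → ι) :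
    Integrable (fun ε => monotoneEnergy n fun i => -ε (e i)) (iidGaussian ι v) :=
  integrable_monotoneEnergy v n (by fun_prop) fun i _ => by simpa using integrable_eval_sq v (e i)

theorem integral_monotoneEnergy_neg_comp {ι : Type*} [Fintype ι] (v : ℝ≥0) (n : ℕ) (e : ℕ → ι)
    (he : Set.InjOn e (Set.Iio n)) :
    ∫ ε, monotoneEnergy n (fun i => -ε (e i)) ∂iidGaussian ι v = v * (harmonic n : ℝ) / 2 := by
  rw [← integral_monotoneEnergy_comp v n e he]
  exact integral_comp_of_measurePreserving (measurePreserving_iidGaussian_neg v)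
    (f := fun ε => monotoneEnergy n fun i => ε (e i))
    ((measurable_monotoneEnergy n).comp (by fun_prop))

/-- The first absolute moment is `√(2v/π)`. -/
theorem sq_integral_abs_gaussianReal (v : ℝ≥0) :
    (∫ x, |x| ∂gaussianReal 0 v) ^ 2 = 2 * v / Real.pi := by
  rcases eq_or_ne v 0 with rfl | hv
  · simp
  have hv' : (0 : ℝ) < v := NNReal.coe_pos.2 (pos_iff_ne_zero.2 hv)
  have h := integral_rpow_mul_exp_neg_mul_rpow (p := 2) (q := 1) (b := 1 / (2 * (v : ℝ)))
    two_pos (by norm_num) (by positivity)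
  have h2 : ∫ x in Set.Ioi (0 : ℝ), x * Real.exp (-x ^ 2 / (2 * v)) = v := by
    rw [show ((1 : ℝ) + 1) / 2 = 1 by norm_num, show (-(1 + 1) / 2 : ℝ) = -1 by norm_num,
      Real.Gamma_one, Real.rpow_neg_one] at h
    have e : (1 / (2 * (v : ℝ)))⁻¹ * (1 / 2) * 1 = v := by field_simp
    rw [e] at h
    refine Eq.trans ?_ h
    refine setIntegral_congr_fun measurableSet_Ioi fun x _ => ?_
    simp only [Real.rpow_one, Real.rpow_two]
    congr 2
    field_simp
  rw [integral_gaussianReal_eq_integral_smul hv]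
  have h3 : ∀ x : ℝ, gaussianPDFReal 0 v x • |x|
      = (√(2 * Real.pi * v))⁻¹ * (|x| * Real.exp (-|x| ^ 2 / (2 * v))) := by
    intro x
    simp only [gaussianPDFReal, sub_zero, sq_abs, smul_eq_mul]
    ring
  simp_rw [h3]
  rw [integral_const_mul,
    integral_comp_abs (f := fun x => x * Real.exp (-x ^ 2 / (2 * v))), h2, mul_pow, inv_pow,
    Real.sq_sqrt (by positivity)]
  field_simp

/-- The sum over the four sign changes of `(z, g)`. -/
theorem sum_sign_flips_posPart (z g : ℝ) :
    (max 0 (z - max 0 (-g))) ^ 2 + (max 0 (-z - max 0 (-g))) ^ 2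
      + (max 0 (z - max 0 (- -g))) ^ 2 + (max 0 (-z - max 0 (- -g))) ^ 2
      = z ^ 2 + (max 0 (|z| - |g|)) ^ 2 := by
  have key : ∀ a : ℝ, 0 ≤ a → (max 0 (z - a)) ^ 2 + (max 0 (-z - a)) ^ 2
      = (max 0 (|z| - a)) ^ 2 := by
    intro a ha
    rcases le_total z 0 with h | h
    · rw [abs_of_nonpos h, max_eq_left (by linarith : z - a ≤ 0)]; ring
    · rw [abs_of_nonneg h, max_eq_left (by linarith : -z - a ≤ 0)]; ring
  have h1 := key _ (le_max_left 0 (-g))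
  have h2 := key _ (le_max_left 0 (- -g))
  have h3 : (max 0 |z|) ^ 2 = z ^ 2 := by rw [max_eq_right (abs_nonneg z), sq_abs]
  have h4 : (max 0 (|z| - max 0 (-g))) ^ 2 + (max 0 (|z| - max 0 (- -g))) ^ 2
      = z ^ 2 + (max 0 (|z| - |g|)) ^ 2 := by
    rw [← h3]
    rcases le_total g 0 with h | h
    · rw [abs_of_nonpos h, max_eq_right (by linarith : (0 : ℝ) ≤ -g), neg_neg, max_eq_left h,
        sub_zero]
      ring
    · rw [abs_of_nonneg h, max_eq_left (by linarith : -g ≤ (0 : ℝ)), neg_neg, max_eq_right h,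
        sub_zero]
  linarith

/-- Averaging over the eight signed permutations of `(z, g)` reduces this second moment to
`𝔼 z² = v` and `(𝔼 |z|)² = 2v/π`. -/
theorem integral_sq_posPart_sub_negPart {ι : Type*} [Fintype ι] (v : ℝ≥0) {i j : ι} (hij : i ≠ j) :
    ∫ ε : ι → ℝ, (max 0 (ε i - max 0 (-ε j))) ^ 2 ∂iidGaussian ι v
      = v * (1 / 2 - 1 / (2 * Real.pi)) := by
  set ν := gaussianReal 0 v with hν
  set Q : ℝ × ℝ → ℝ := fun p => (max 0 (p.1 - max 0 (-p.2))) ^ 2 with hQdef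
  have hQ : Measurable Q := by fun_prop
  have hsq := integrable_sq_gaussianReal v
  have habs : Integrable (fun x => |x|) ν := ((memLp_id_gaussianReal 1).integrable le_rfl).abs
  have i1 : Integrable (fun p : ℝ × ℝ => p.1 ^ 2) (ν.prod ν) := hsq.comp_fst ν
  have i2 : Integrable (fun p : ℝ × ℝ => p.2 ^ 2) (ν.prod ν) := hsq.comp_snd ν
  have i3 : Integrable (fun p : ℝ × ℝ => |p.1| * |p.2|) (ν.prod ν) := habs.mul_prod habs
  have iQ : Integrable Q (ν.prod ν) := by
    refine (i1.add i1).mono' hQ.aestronglyMeasurable (Filter.Eventually.of_forall fun p => ?_)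
    have h0 := sq_nonneg p.1
    have h1 : Q p ≤ (max 0 p.1) ^ 2 := by
      refine pow_le_pow_left₀ (le_max_left _ _) (max_le_max le_rfl ?_) 2
      linarith [le_max_left 0 (-p.2)]
    have h2 := sq_max_zero_le p.1
    rw [Real.norm_of_nonneg (sq_nonneg _)]
    simp only [Pi.add_apply]
    linarith
  have hneg : MeasurePreserving (fun x : ℝ => -x) ν ν :=
    ⟨measurable_neg, by rw [hν, gaussianReal_map_neg, neg_zero]⟩
  have n1 : MeasurePreserving (fun p : ℝ × ℝ => (-p.1, p.2)) (ν.prod ν) (ν.prod ν) :=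
    hneg.prod (.id ν)
  have n2 : MeasurePreserving (fun p : ℝ × ℝ => (p.1, -p.2)) (ν.prod ν) (ν.prod ν) :=
    (MeasurePreserving.id ν).prod hneg
  have n3 : MeasurePreserving (fun p : ℝ × ℝ => (-p.1, -p.2)) (ν.prod ν) (ν.prod ν) :=
    hneg.prod hneg
  have n4 : MeasurePreserving (Prod.swap : ℝ × ℝ → ℝ × ℝ) (ν.prod ν) (ν.prod ν) :=
    Measure.measurePreserving_swap
  set R : ℝ × ℝ → ℝ := fun p => Q p + Q (-p.1, p.2) + Q (p.1, -p.2) + Q (-p.1, -p.2) with hR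
  have iR : Integrable R (ν.prod ν) :=
    ((iQ.add (n1.integrable_comp_of_integrable iQ)).add (n2.integrable_comp_of_integrable iQ)).add
      (n3.integrable_comp_of_integrable iQ)
  have eR : ∫ p, R p ∂ν.prod ν = 4 * ∫ p, Q p ∂ν.prod ν := by
    have j1 := n1.integrable_comp_of_integrable iQ
    have j2 := n2.integrable_comp_of_integrable iQ
    have j3 := n3.integrable_comp_of_integrable iQ
    simp only [Function.comp_def] at j1 j2 j3
    have k1 := integral_comp_of_measurePreserving n1 hQ
    have k2 := integral_comp_of_measurePreserving n2 hQ
    have k3 := integral_comp_of_measurePreserving n3 hQ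
    have l1 := integral_add iQ j1
    have l2 := integral_add (iQ.add j1) j2
    have l3 := integral_add ((iQ.add j1).add j2) j3
    simp only [Pi.add_apply] at l1 l2 l3
    simp only [hR]
    linarith
  have eS := integral_comp_of_measurePreserving n4 (f := R) (by fun_prop)
  have iS : Integrable (fun p : ℝ × ℝ => R p.swap) (ν.prod ν) := n4.integrable_comp_of_integrable iR
  have hsum : ∀ p : ℝ × ℝ, R p + R p.swap = 2 * p.1 ^ 2 + 2 * p.2 ^ 2 - 2 * (|p.1| * |p.2|) := by
    rintro ⟨z, g⟩
    have h1 := sum_sign_flips_posPart z g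
    have h2 := sum_sign_flips_posPart g z
    have h3 := sq_max_zero_add (|z| - |g|)
    rw [neg_sub] at h3
    simp only [hR, hQdef, Prod.swap]
    have h4 : (|z| - |g|) ^ 2 = z ^ 2 + g ^ 2 - 2 * (|z| * |g|) := by
      rw [← sq_abs z, ← sq_abs g]; ring
    linarith
  have htot := integral_add iR iS
  simp_rw [hsum] at htot
  have m1 : ∫ p : ℝ × ℝ, p.1 ^ 2 ∂ν.prod ν = v := by
    rw [integral_fun_fst (fun x : ℝ => x ^ 2)]; simp [integral_sq_gaussianReal, hν]
  have m2 : ∫ p : ℝ × ℝ, p.2 ^ 2 ∂ν.prod ν = v := by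
    rw [integral_fun_snd (fun x : ℝ => x ^ 2)]; simp [integral_sq_gaussianReal, hν]
  have m3 : ∫ p : ℝ × ℝ, |p.1| * |p.2| ∂ν.prod ν = 2 * v / Real.pi := by
    rw [integral_prod_mul (fun x : ℝ => |x|) fun x : ℝ => |x|, ← sq,
      sq_integral_abs_gaussianReal]
  have l1 := integral_add (i1.const_mul 2) (i2.const_mul 2)
  have l2 := integral_sub ((i1.const_mul 2).add (i2.const_mul 2)) (i3.const_mul 2)
  simp only [Pi.add_apply, integral_const_mul, m1, m2, m3] at l1 l2
  have final := integral_comp_of_measurePreserving (measurePreserving_iidGaussian_pair v hij) hQ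
  have hval : ∫ p, Q p ∂ν.prod ν = v * (1 / 2 - 1 / (2 * Real.pi)) := by
    have : (v : ℝ) * (1 / 2 - 1 / (2 * Real.pi)) = (4 * v - 2 * (2 * v / Real.pi)) / 8 := by
      field_simp; ring
    rw [this]
    linarith
  rw [← hval, ← final]

/-! ### Least squares and flows on spider trees -/

/-- Oracle inequality: comparison of the least squares estimate with an arbitrary flow `u`. -/
theorem ParentTree.IsLeastSquares.oracle {ι : Type*} [Fintype ι] [DecidableEq ι]
    {T : ParentTree ι} {μ ε f u : ι → ℝ} (hf : T.IsLeastSquares (μ + ε) f) (hu : u ∈ T.flows) :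
    ∑ i, (f i - μ i) ^ 2
      ≤ ∑ i, (u i - μ i) ^ 2 + ∑ i, (2 * ε i * (f i - u i) - (f i - u i) ^ 2) := by
  set a := ∑ i, (μ i + ε i - f i) * (u i - f i) with ha
  set b := ∑ i, (u i - f i) ^ 2 with hb
  have hb0 : 0 ≤ b := Finset.sum_nonneg fun i _ => sq_nonneg _
  have hvar : a ≤ 0 := by
    by_contra! hc
    -- the step towards `u` is short enough for its linear gain to exceed its quadratic loss
    set t := a / (a + b) with ht
    have hab : 0 < a + b := by linarith
    have ht0 : 0 < t := by positivity
    have ht1 : t ≤ 1 := (div_le_one hab).2 (by linarith)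
    have hflow : (1 - t) • f + t • u ∈ T.flows :=
      T.convex_flows hf.1 hu (by linarith) ht0.le (by ring)
    have h1 := hf.2 _ hflow
    have h2 : ∑ i, ((μ + ε) i - ((1 - t) • f + t • u) i) ^ 2
        = ∑ i, ((μ + ε) i - f i) ^ 2 - 2 * t * a + t ^ 2 * b := by
      rw [ha, hb, Finset.mul_sum, Finset.mul_sum, ← Finset.sum_sub_distrib,
        ← Finset.sum_add_distrib]
      refine Finset.sum_congr rfl fun i _ => ?_
      simp only [Pi.add_apply, Pi.smul_apply, smul_eq_mul]
      ring
    rw [h2] at h1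
    have h3 : t * (2 * a) ≤ t * (t * b) := by nlinarith
    have h4 := le_of_mul_le_mul_left h3 ht0
    have h5 : t * (a + b) = a := div_mul_cancel₀ _ hab.ne'
    nlinarith
  have hid : ∑ i, (f i - μ i) ^ 2 - (∑ i, (u i - μ i) ^ 2
      + ∑ i, (2 * ε i * (f i - u i) - (f i - u i) ^ 2)) = 2 * a := by
    rw [ha, Finset.mul_sum, ← Finset.sum_add_distrib, ← Finset.sum_sub_distrib]
    exact Finset.sum_congr rfl fun i _ => by ring
  linarith

theorem sum_children_spiderTree_none {m l : ℕ} (hl : 0 < l) (f : Option (Fin m × Fin l) → ℝ) :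
    ∑ i ∈ (spiderTree m l).children none, f i = ∑ j, f (some (j, ⟨0, hl⟩)) := by
  have h : (spiderTree m l).children none
      = Finset.univ.map ⟨fun j : Fin m => some (j, (⟨0, hl⟩ : Fin l)), fun a b hab => by
        simpa using hab⟩ := by
    ext i
    simp only [ParentTree.children, Finset.mem_filter, Finset.mem_univ, true_and, Finset.mem_map]
    constructor
    · rcases i with _ | ⟨j, k, hk⟩
      · exact fun h => absurd rfl h.1
      · cases k with
        | zero => exact fun _ => ⟨j, rfl⟩
        | succ k => exact fun h => absurd h.2 (by simp [spiderTree, spiderParent])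
    · rintro ⟨j, rfl⟩
      exact ⟨by simp [spiderTree], rfl⟩
  rw [h, Finset.sum_map]
  rfl

theorem sum_children_spiderTree_some {m l : ℕ} (f : Option (Fin m × Fin l) → ℝ) (j : Fin m)
    (k : ℕ) (hk : k < l) :
    ∑ i ∈ (spiderTree m l).children (some (j, ⟨k, hk⟩)), f i
      = if h : k + 1 < l then f (some (j, ⟨k + 1, h⟩)) else 0 := by
  have hmem : ∀ i, i ∈ (spiderTree m l).children (some (j, ⟨k, hk⟩))
      ↔ ∃ h : k + 1 < l, i = some (j, ⟨k + 1, h⟩) := by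
    intro i
    simp only [ParentTree.children, Finset.mem_filter, Finset.mem_univ, true_and]
    constructor
    · rcases i with _ | ⟨j', k', hk'⟩
      · exact fun h => absurd rfl h.1
      · cases k' with
        | zero => exact fun h => absurd h.2 (by simp [spiderTree, spiderParent])
        | succ k' =>
          intro h
          have h2 := h.2
          simp only [spiderTree, spiderParent, Option.some.injEq, Prod.mk.injEq,
            Fin.mk.injEq] at h2
          obtain ⟨rfl, rfl⟩ := h2
          exact ⟨hk', rfl⟩
    · rintro ⟨h, rfl⟩
      exact ⟨by simp [spiderTree], rfl⟩
  split_ifs with h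
  · rw [show (spiderTree m l).children (some (j, ⟨k, hk⟩)) = {some (j, ⟨k + 1, h⟩)} by
      ext i; rw [hmem]; simp [h], Finset.sum_singleton]
  · rw [show (spiderTree m l).children (some (j, ⟨k, hk⟩)) = ∅ by
      ext i; rw [hmem]; simp [h], Finset.sum_empty]

/-- A flow on a spider is a nonincreasing nonnegative sequence on each path, with top values whose
sum is at most the root value. -/
theorem mem_flows_spiderTree {m l : ℕ} (hl : 0 < l) {f : Option (Fin m × Fin l) → ℝ} :
    f ∈ (spiderTree m l).flows ↔ ∑ j, f (some (j, ⟨0, hl⟩)) ≤ f none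
      ∧ ∀ j, Antitone (fun i => f (some (j, i))) ∧ ∀ i, 0 ≤ f (some (j, i)) := by
  obtain ⟨l, rfl⟩ : ∃ l', l = l' + 1 := ⟨l - 1, by omega⟩
  have hflow : f ∈ (spiderTree m (l + 1)).flows ↔ ∑ j, f (some (j, ⟨0, hl⟩)) ≤ f none
      ∧ ∀ j k (hk : k < l + 1),
        (if h : k + 1 < l + 1 then f (some (j, ⟨k + 1, h⟩)) else 0) ≤ f (some (j, ⟨k, hk⟩)) := by
    constructor
    · intro h
      refine ⟨?_, fun j k hk => ?_⟩
      · rw [← sum_children_spiderTree_none]; exact h none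
      · rw [← sum_children_spiderTree_some]; exact h _
    · rintro ⟨h1, h2⟩ (_ | ⟨j, k, hk⟩)
      · rw [sum_children_spiderTree_none hl]; exact h1
      · rw [sum_children_spiderTree_some]; exact h2 j k hk
  rw [hflow]
  refine and_congr_right fun _ => forall_congr' fun j => ⟨fun h => ?_, fun h k hk => ?_⟩
  · have hanti : Antitone fun i : Fin (l + 1) => f (some (j, i)) := by
      rw [Fin.antitone_iff_succ_le]
      intro i
      have := h i (by omega)
      rwa [dif_pos (by omega)] at this
    refine ⟨hanti, fun i => ?_⟩
    have h1 := h l (by omega)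
    rw [dif_neg (by omega)] at h1
    exact h1.trans (hanti (Fin.le_last i))
  · split_ifs with h'
    · exact h.1 (Fin.mk_le_mk.2 k.le_succ)
    · exact h.2 _

/-- The increasing enumeration of a finite set, continued by the constant `d`. -/
def orderEnum {κ : Type*} [LinearOrder κ] (d : κ) (B : Finset κ) (i : ℕ) : κ :=
  if h : i < B.card then B.orderEmbOfFin rfl ⟨i, h⟩ else d

section orderEnum

variable {κ : Type*} [LinearOrder κ] (d : κ) (B : Finset κ)

theorem injOn_orderEnum : Set.InjOn (orderEnum d B) (Set.Iio B.card) := by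
  intro i hi j hj hij
  simp only [orderEnum, dif_pos (Set.mem_Iio.1 hi), dif_pos (Set.mem_Iio.1 hj)] at hij
  simpa using hij

theorem orderEnum_le {i j : ℕ} (hij : i ≤ j) (hj : j < B.card) :
    orderEnum d B i ≤ orderEnum d B j := by
  rw [orderEnum, orderEnum, dif_pos (hij.trans_lt hj), dif_pos hj]
  exact (B.orderEmbOfFin rfl).monotone (Fin.mk_le_mk.2 hij)

theorem orderEnum_mem {i : ℕ} (hi : i < B.card) : orderEnum d B i ∈ B := by
  rw [orderEnum, dif_pos hi]
  exact B.orderEmbOfFin_mem rfl _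

theorem sum_orderEnum (φ : κ → ℝ) :
    ∑ i ∈ B, φ i = ∑ i ∈ Finset.range B.card, φ (orderEnum d B i) := by
  rw [Finset.sum_range, ← Finset.sum_coe_sort, ← (B.orderIsoOfFin rfl).toEquiv.sum_comp]
  refine Finset.sum_congr rfl fun i _ => ?_
  simp [orderEnum]

theorem quadratic_le_monotoneEnergy_orderEnum {x h : κ → ℝ}
    (hh : ∀ i ∈ B, ∀ j ∈ B, i ≤ j → h j ≤ h i) (h0 : ∀ i ∈ B, 0 ≤ h i) :
    ∑ i ∈ B, (2 * x i * h i - h i ^ 2)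
      ≤ monotoneEnergy B.card fun i => x (orderEnum d B i) := by
  rw [sum_orderEnum d]
  exact quadratic_le_monotoneEnergy _ (fun i => x (orderEnum d B i))
    (fun i => h (orderEnum d B i))
    (fun i j hij hj => hh _ (orderEnum_mem d B (hij.trans_lt hj)) _ (orderEnum_mem d B hj)
      (orderEnum_le d B hij hj)) fun i hi => h0 _ (orderEnum_mem d B hi)

/-- Without the sign constraint, the positive and the negative part of `h` are each nonincreasing,
the latter after reversal. -/
theorem quadratic_le_monotoneEnergy_add_rev {x h : κ → ℝ}
    (hh : ∀ i ∈ B, ∀ j ∈ B, i ≤ j → h j ≤ h i) :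
    ∑ i ∈ B, (2 * x i * h i - h i ^ 2)
      ≤ monotoneEnergy B.card (fun i => x (orderEnum d B i))
        + monotoneEnergy B.card fun i => -x (orderEnum d B (B.card - 1 - i)) := by
  have h1 := quadratic_le_monotoneEnergy_orderEnum d B (x := x) (h := fun i => max 0 (h i))
    (fun i hi j hj hij => max_le_max le_rfl (hh i hi j hj hij)) fun i _ => le_max_left _ _
  have h2 := quadratic_le_monotoneEnergy B.card (fun i => -x (orderEnum d B (B.card - 1 - i)))
    (fun i => max 0 (-h (orderEnum d B (B.card - 1 - i))))
    (fun i j hij hj => max_le_max le_rfl (neg_le_neg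
      (hh _ (orderEnum_mem d B (by omega)) _ (orderEnum_mem d B (by omega))
        (orderEnum_le d B (by omega) (by omega))))) fun i _ => le_max_left _ _
  rw [Finset.sum_range_reflect (fun i => 2 * -x (orderEnum d B i) * max 0 (-h (orderEnum d B i))
    - (max 0 (-h (orderEnum d B i))) ^ 2), ← sum_orderEnum d B
    fun i => 2 * -x i * max 0 (-h i) - (max 0 (-h i)) ^ 2] at h2
  refine le_trans (le_of_eq ?_) (add_le_add h1 h2)
  rw [← Finset.sum_add_distrib]
  refine Finset.sum_congr rfl fun i _ => ?_
  rcases le_total (h i) 0 with hi | hi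
  · rw [max_eq_left hi, max_eq_right (by linarith)]; ring
  · rw [max_eq_right hi, max_eq_left (by linarith)]; ring

end orderEnum

/-! ### Upper bounds on the squared error by comparison flows -/

/-- An integrable pointwise bound of the squared error bounds the risk. Measurability of the least
squares estimate plays no role, the lower integral being monotone for all functions. -/
theorem ParentTree.worstCaseRisk_le {ι : Type*} [Fintype ι] [DecidableEq ι] (T : ParentTree ι)
    (n : ℕ) (σ : ℝ≥0) (V b : ℝ)
    (h : ∀ μ ∈ T.flows, μ T.root ≤ V → ∃ g : (ι → ℝ) → ℝ, Integrable g (iidGaussian ι (σ ^ 2)) ∧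
      (∀ ε, ∑ i, (T.leastSquares (μ + ε) i - μ i) ^ 2 ≤ g ε) ∧
      ∫ ε, g ε ∂iidGaussian ι (σ ^ 2) ≤ b) :
    T.worstCaseRisk n σ V ≤ ENNReal.ofReal (1 / n * b) := by
  refine iSup_le fun μ => iSup_le fun hμ => iSup_le fun hV => ?_
  obtain ⟨g, hg, hle, hb⟩ := h μ hμ hV
  have hn : (0 : ℝ) ≤ 1 / n := by positivity
  calc _ ≤ ∫⁻ ε, ENNReal.ofReal (1 / n * g ε) ∂iidGaussian ι (σ ^ 2) :=
        lintegral_mono fun ε => ENNReal.ofReal_le_ofReal (mul_le_mul_of_nonneg_left (hle ε) hn)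
    _ = ENNReal.ofReal (∫ ε, 1 / n * g ε ∂iidGaussian ι (σ ^ 2)) := by
        rw [ofReal_integral_eq_lintegral_ofReal (hg.const_mul _)]
        refine Filter.Eventually.of_forall fun ε => mul_nonneg hn ?_
        exact (Finset.sum_nonneg fun i _ => sq_nonneg _).trans (hle ε)
    _ ≤ _ := by
        rw [integral_const_mul]
        exact ENNReal.ofReal_le_ofReal (mul_le_mul_of_nonneg_left hb hn)

theorem harmonic_cast_mono {a b : ℕ} (h : a ≤ b) : (harmonic a : ℝ) ≤ harmonic b := by
  have : harmonic a ≤ harmonic b :=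
    Finset.sum_le_sum_of_subset_of_nonneg (Finset.range_mono h) fun i _ _ => by positivity
  exact_mod_cast this

theorem harmonic_cast_nonneg (a : ℕ) : (0 : ℝ) ≤ harmonic a := by
  simpa using harmonic_cast_mono a.zero_le

/-- The index of the level of the uniform grid `0, 2w, 4w, …` which approximates `y` within `w`. -/
noncomputable def gridIndex (w y : ℝ) : ℕ := ⌈(y - w) / (2 * w)⌉₊

theorem gridIndex_mono {w : ℝ} (hw : 0 ≤ w) : Monotone (gridIndex w) := fun a b h =>
  Nat.ceil_mono (div_le_div_of_nonneg_right (by linarith) (by linarith))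

theorem sq_grid_sub_le {w y : ℝ} (hy : 0 ≤ y) (hw : 0 < w ∨ y = 0 ∧ w = 0) :
    (2 * w * gridIndex w y - y) ^ 2 ≤ w ^ 2 := by
  rcases hw with hw | ⟨rfl, rfl⟩
  · have h1 := Nat.le_ceil ((y - w) / (2 * w))
    rw [div_le_iff₀ (by positivity)] at h1
    refine sq_le_sq' (by rw [gridIndex]; linarith) ?_
    rcases le_or_gt y w with h | h
    · rw [gridIndex, Nat.ceil_eq_zero.2 (div_nonpos_of_nonpos_of_nonneg (by linarith)
        (by linarith))]
      push_cast
      linarith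
    · have h2 := Nat.ceil_lt_add_one (div_nonneg (by linarith : 0 ≤ y - w)
        (by linarith : 0 ≤ 2 * w))
      rw [← sub_lt_iff_lt_add, lt_div_iff₀ (by positivity)] at h2
      rw [gridIndex]
      linarith
  · simp

theorem gridIndex_le {v : ℝ} (hv : 0 ≤ v) (k : ℕ) {y : ℝ} (hy : y ≤ v) :
    gridIndex (v / (2 * k + 1)) y ≤ k := by
  rw [gridIndex, Nat.ceil_le]
  rcases hv.eq_or_lt with rfl | hv
  · simp
  · rw [div_le_iff₀ (by positivity)]
    refine (sub_le_sub_right hy _).trans (le_of_eq ?_)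
    field_simp
    ring

/-- The bound `quadratic_le_monotoneEnergy_orderEnum` on a block `B` with a sign constraint. -/
noncomputable def signedBlockEnergy {κ : Type*} [LinearOrder κ] (d : κ) (B : Finset κ)
    (x : κ → ℝ) : ℝ :=
  monotoneEnergy B.card fun i => x (orderEnum d B i)

/-- The bound `quadratic_le_monotoneEnergy_add_rev` on a block `B` without sign constraint. -/
noncomputable def freeBlockEnergy {κ : Type*} [LinearOrder κ] (d : κ) (B : Finset κ)
    (x : κ → ℝ) : ℝ :=
  monotoneEnergy B.card (fun i => x (orderEnum d B i))
    + monotoneEnergy B.card fun i => -x (orderEnum d B (B.card - 1 - i))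

section blockEnergy

variable {ι κ : Type*} [Fintype ι] [LinearOrder κ] (v : ℝ≥0) (d : κ) (B : Finset κ) {p : κ → ι}

theorem integrable_signedBlockEnergy :
    Integrable (fun ε => signedBlockEnergy d B fun i => ε (p i)) (iidGaussian ι v) :=
  integrable_monotoneEnergy_comp v _ fun i => p (orderEnum d B i)

theorem integrable_freeBlockEnergy :
    Integrable (fun ε => freeBlockEnergy d B fun i => ε (p i)) (iidGaussian ι v) :=
  (integrable_signedBlockEnergy v d B).add
    (integrable_monotoneEnergy_neg_comp v _ fun i => p (orderEnum d B (B.card - 1 - i)))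

theorem integral_signedBlockEnergy (hp : Function.Injective p) :
    ∫ ε, signedBlockEnergy d B (fun i => ε (p i)) ∂iidGaussian ι v
      = v * (harmonic B.card : ℝ) / 2 :=
  integral_monotoneEnergy_comp v _ _ (hp.injOn.comp (injOn_orderEnum d B) (Set.mapsTo_univ _ _))

theorem integral_freeBlockEnergy (hp : Function.Injective p) :
    ∫ ε, freeBlockEnergy d B (fun i => ε (p i)) ∂iidGaussian ι v = v * (harmonic B.card : ℝ) := by
  have hinj : Set.InjOn (fun i => p (orderEnum d B (B.card - 1 - i))) (Set.Iio B.card) := by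
    refine (hp.injOn.comp (injOn_orderEnum d B) (Set.mapsTo_univ _ _)).comp
      (f := fun i => B.card - 1 - i) (fun a ha b hb hab => ?_) fun a ha => ?_
    · have h1 := Set.mem_Iio.1 ha
      have h2 := Set.mem_Iio.1 hb
      simp only at hab
      omega
    · have h1 := Set.mem_Iio.1 ha
      show B.card - 1 - a < B.card
      omega
  have h := integral_add (integrable_signedBlockEnergy (p := p) v d B)
    (integrable_monotoneEnergy_neg_comp v B.card fun i => p (orderEnum d B (B.card - 1 - i)))
  rw [integral_signedBlockEnergy v d B hp, integral_monotoneEnergy_neg_comp v _ _ hinj] at h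
  exact h.trans (by ring)

end blockEnergy

/-- Bound for the quadratic functional of the noise on increments from a sequence which is constant
on the level sets of `c`: the level `0` carries a sign constraint, the levels `1, …, k` do not. -/
noncomputable def levelEnergy {l : ℕ} (d : Fin l) (c : Fin l → ℕ) (k : ℕ) (x : Fin l → ℝ) : ℝ :=
  signedBlockEnergy d (Finset.univ.filter fun i => c i = 0) x
    + ∑ r ∈ Finset.range k, freeBlockEnergy d (Finset.univ.filter fun i => c i = r + 1) x

theorem quadratic_le_levelEnergy {l : ℕ} (d : Fin l) (c : Fin l → ℕ) {k : ℕ} (hk : ∀ i, c i ≤ k)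
    {q : ℕ → ℝ} (hq : q 0 = 0) (x : Fin l → ℝ) {f : Fin l → ℝ} (hf : Antitone f)
    (hf0 : ∀ i, 0 ≤ f i) :
    ∑ i, (2 * x i * (f i - q (c i)) - (f i - q (c i)) ^ 2) ≤ levelEnergy d c k x := by
  rw [← Finset.sum_fiberwise_of_maps_to (t := Finset.range (k + 1)) (g := c)
    (fun i _ => Finset.mem_range.2 (Nat.lt_succ_of_le (hk i))), Finset.sum_range_succ', add_comm]
  have hmono : ∀ r, ∀ i ∈ Finset.univ.filter (fun i => c i = r),
      ∀ j ∈ Finset.univ.filter (fun i => c i = r), i ≤ j → f j - q (c j) ≤ f i - q (c i) := by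
    intro r i hi j hj hij
    rw [(Finset.mem_filter.1 hi).2, (Finset.mem_filter.1 hj).2]
    exact sub_le_sub_right (hf hij) _
  refine add_le_add ?_ (Finset.sum_le_sum fun r _ => ?_)
  · refine quadratic_le_monotoneEnergy_orderEnum d _ (x := x) (h := fun i => f i - q (c i))
      (hmono 0) fun i hi => ?_
    rw [(Finset.mem_filter.1 hi).2, hq, sub_zero]
    exact hf0 i
  · exact quadratic_le_monotoneEnergy_add_rev d _ (x := x) (h := fun i => f i - q (c i))
      (hmono (r + 1))

theorem integrable_levelEnergy {ι : Type*} [Fintype ι] (v : ℝ≥0) {l : ℕ} (d : Fin l)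
    (c : Fin l → ℕ) (k : ℕ) (p : Fin l → ι) :
    Integrable (fun ε => levelEnergy d c k fun i => ε (p i)) (iidGaussian ι v) :=
  (integrable_signedBlockEnergy v d _).add
    (integrable_finsetSum _ fun _ _ => integrable_freeBlockEnergy v d _)

theorem integral_levelEnergy_le {ι : Type*} [Fintype ι] (v : ℝ≥0) {l : ℕ} (d : Fin l)
    (c : Fin l → ℕ) (k : ℕ) {p : Fin l → ι} (hp : Function.Injective p) :
    ∫ ε, levelEnergy d c k (fun i => ε (p i)) ∂iidGaussian ι v
      ≤ v * (harmonic l / 2 + k * harmonic l) := by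
  have hv : (0 : ℝ) ≤ v := v.2
  have hcard : ∀ B : Finset (Fin l), v * (harmonic B.card : ℝ) ≤ v * (harmonic l : ℝ) :=
    fun B => mul_le_mul_of_nonneg_left
      (harmonic_cast_mono (B.card_le_univ.trans_eq (Fintype.card_fin l))) hv
  unfold levelEnergy
  rw [integral_add (integrable_signedBlockEnergy v d _)
      (integrable_finsetSum _ fun _ _ => integrable_freeBlockEnergy v d _),
    integral_finsetSum _ fun _ _ => integrable_freeBlockEnergy v d _,
    integral_signedBlockEnergy v d _ hp]
  have hsum : ∑ r ∈ Finset.range k, ∫ ε,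
        freeBlockEnergy d (Finset.univ.filter fun i => c i = r + 1) (fun i => ε (p i))
          ∂iidGaussian ι v
      ≤ ∑ r ∈ Finset.range k, v * (harmonic l : ℝ) :=
    Finset.sum_le_sum fun r _ => (integral_freeBlockEnergy v d _ hp).trans_le (hcard _)
  rw [Finset.sum_const, Finset.card_range, nsmul_eq_mul] at hsum
  have := hcard (Finset.univ.filter fun i => c i = 0)
  linarith

theorem injective_some_mk {m l : ℕ} (j : Fin m) :
    Function.Injective fun i : Fin l => (some (j, i) : Option (Fin m × Fin l)) := fun a b h => by
  simpa using h

theorem sum_spider {m l : ℕ} (φ : Option (Fin m × Fin l) → ℝ) :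
    ∑ i, φ i = φ none + ∑ j, ∑ i, φ (some (j, i)) := by
  rw [Fintype.sum_option, Fintype.sum_prod_type]

/-- Comparison with the flow which has the root value of `μ` and rounds `μ` on the path `j` to a
grid with `k j` nonzero levels. -/
theorem exists_bound_of_levels {m l : ℕ} (hl : 0 < l) (v : ℝ≥0)
    {μ : Option (Fin m × Fin l) → ℝ} (hμ : μ ∈ (spiderTree m l).flows) (k : Fin m → ℕ) :
    ∃ g, Integrable g (iidGaussian (Option (Fin m × Fin l)) v) ∧
      (∀ ε, ∑ i, ((spiderTree m l).leastSquares (μ + ε) i - μ i) ^ 2 ≤ g ε) ∧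
      ∫ ε, g ε ∂iidGaussian (Option (Fin m × Fin l)) v
        ≤ ∑ j, l * (μ (some (j, ⟨0, hl⟩)) / (2 * k j + 1)) ^ 2
          + v * (1 + m * harmonic l / 2 + harmonic l * ∑ j, (k j : ℝ)) := by
  obtain ⟨hroot, hpath⟩ := (mem_flows_spiderTree hl).1 hμ
  -- `k j` intervals of length `2 w j` around the nonzero levels and one of length `w j` above `0`
  -- make up the range `[0, μ (j, 0)]`
  set w : Fin m → ℝ := fun j => μ (some (j, ⟨0, hl⟩)) / (2 * k j + 1) with hw
  set c : Fin m → Fin l → ℕ := fun j i => gridIndex (w j) (μ (some (j, i))) with hc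
  have htop : ∀ j i, μ (some (j, i)) ≤ μ (some (j, ⟨0, hl⟩)) := fun j i =>
    (hpath j).1 (Fin.mk_le_mk.2 (Nat.zero_le i))
  have htop0 : ∀ j, 0 ≤ μ (some (j, ⟨0, hl⟩)) := fun j => (hpath j).2 _
  have hw0 : ∀ j, 0 ≤ w j := fun j => div_nonneg (htop0 j) (by positivity)
  have hck : ∀ j i, c j i ≤ k j := fun j i => gridIndex_le (htop0 j) (k j) (htop j i)
  set u : Option (Fin m × Fin l) → ℝ := fun i =>
    i.elim (μ none) fun p => 2 * w p.1 * c p.1 p.2 with hu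
  have huflow : u ∈ (spiderTree m l).flows := by
    refine (mem_flows_spiderTree hl).2 ⟨(Finset.sum_le_sum fun j _ => ?_).trans hroot, fun j =>
      ⟨fun a b hab => ?_, fun i => ?_⟩⟩
    · have h1 : (c j ⟨0, hl⟩ : ℝ) ≤ k j := by exact_mod_cast hck j _
      have h2 : w j * (2 * k j + 1) = μ (some (j, ⟨0, hl⟩)) :=
        div_mul_cancel₀ _ (by positivity)
      have h3 := mul_le_mul_of_nonneg_left h1 (hw0 j)
      have h4 := hw0 j
      simp only [hu, Option.elim_some]
      linarith
    · have h1 : (c j b : ℝ) ≤ c j a := by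
        exact_mod_cast gridIndex_mono (hw0 j) ((hpath j).1 hab)
      have h3 := mul_le_mul_of_nonneg_left h1 (hw0 j)
      simp only [hu, Option.elim_some]
      linarith
    · have := hw0 j
      simp only [hu, Option.elim_some]
      positivity
  set A := ∑ j, l * (w j) ^ 2 with hA
  have hbias : ∑ i, (u i - μ i) ^ 2 ≤ A := by
    rw [sum_spider]
    simp only [hu, Option.elim_none, sub_self, Option.elim_some, hA]
    rw [zero_pow two_ne_zero, zero_add]
    refine Finset.sum_le_sum fun j _ => ?_
    refine (Finset.sum_le_card_nsmul _ _ (w j ^ 2) fun i _ => ?_).trans_eq (by simp)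
    refine sq_grid_sub_le ((hpath j).2 i) ?_
    rcases (htop0 j).eq_or_lt with h0 | h0
    · refine Or.inr ⟨le_antisymm ((htop j i).trans_eq h0.symm) ((hpath j).2 i), ?_⟩
      simp only [hw, ← h0, zero_div]
    · exact Or.inl (div_pos h0 (by positivity))
  have i1 := integrable_eval_sq v (none : Option (Fin m × Fin l))
  have i2 := fun j => integrable_levelEnergy v ⟨0, hl⟩ (c j) (k j)
    fun i => (some (j, i) : Option (Fin m × Fin l))
  have i3 : Integrable (fun ε : Option (Fin m × Fin l) → ℝ =>
      ∑ j, levelEnergy ⟨0, hl⟩ (c j) (k j) fun i => ε (some (j, i))) (iidGaussian _ v) :=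
    integrable_finsetSum _ fun j _ => i2 j
  refine ⟨fun ε => A + (ε none ^ 2 + ∑ j, levelEnergy ⟨0, hl⟩ (c j) (k j) fun i => ε (some (j, i))),
    (integrable_const _).add (i1.add i3), fun ε => ?_, ?_⟩
  · have hLS := (spiderTree m l).isLeastSquares_leastSquares (μ + ε)
    set f := (spiderTree m l).leastSquares (μ + ε)
    obtain ⟨-, hf⟩ := (mem_flows_spiderTree hl).1 hLS.1
    refine (hLS.oracle huflow).trans (add_le_add hbias ?_)
    rw [sum_spider]
    refine add_le_add ?_ (Finset.sum_le_sum fun j _ => ?_)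
    · nlinarith [sq_nonneg (ε none - (f none - u none))]
    · exact quadratic_le_levelEnergy ⟨0, hl⟩ (c j) (hck j) (q := fun r => 2 * w j * r) (by simp)
        (fun i => ε (some (j, i))) (hf j).1 (hf j).2
  · have i4 : Integrable (fun ε : Option (Fin m × Fin l) → ℝ => ε none ^ 2
        + ∑ j, levelEnergy ⟨0, hl⟩ (c j) (k j) fun i => ε (some (j, i))) (iidGaussian _ v) :=
      i1.add i3
    rw [integral_add (integrable_const _) i4, integral_const, probReal_univ, one_smul,
      integral_add i1 i3, integral_eval_sq, integral_finsetSum _ fun j _ => i2 j]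
    have h1 : ∑ j, ∫ ε : Option (Fin m × Fin l) → ℝ, levelEnergy ⟨0, hl⟩ (c j) (k j)
        (fun i => ε (some (j, i))) ∂iidGaussian _ v
        ≤ ∑ j, v * ((harmonic l : ℝ) / 2 + k j * harmonic l) :=
      Finset.sum_le_sum fun j _ => integral_levelEnergy_le v _ _ _ (injective_some_mk j)
    rw [← Finset.mul_sum, Finset.sum_add_distrib, ← Finset.sum_mul] at h1
    simp only [Finset.sum_const, Finset.card_univ, Fintype.card_fin, nsmul_eq_mul] at h1
    have h2 : (v : ℝ) * (1 + m * harmonic l / 2 + harmonic l * ∑ j, (k j : ℝ))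
        = v + v * (m * (harmonic l / 2) + (∑ j, (k j : ℝ)) * harmonic l) := by ring
    rw [h2]
    linarith

/-- The vertex number `i` of the path `j`, and the root beyond the end of the path. -/
def pathVertex {m l : ℕ} (j : Fin m) (i : ℕ) : Option (Fin m × Fin l) :=
  if h : i < l then some (j, ⟨i, h⟩) else none

theorem pathVertex_of_lt {m l : ℕ} (j : Fin m) {i : ℕ} (h : i < l) :
    pathVertex (l := l) j i = some (j, ⟨i, h⟩) := dif_pos h

theorem injOn_pathVertex {m l : ℕ} (j : Fin m) :
    Set.InjOn (pathVertex (l := l) j) (Set.Iio l) := by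
  intro a ha b hb hab
  rw [pathVertex_of_lt j ha, pathVertex_of_lt j hb] at hab
  exact congrArg Fin.val (injective_some_mk j hab)

theorem sum_path {m l : ℕ} (φ : Option (Fin m × Fin l) → ℝ) (j : Fin m) :
    ∑ i, φ (some (j, i)) = ∑ i ∈ Finset.range l, φ (pathVertex j i) := by
  rw [Finset.sum_range]
  exact Finset.sum_congr rfl fun i _ => by rw [pathVertex_of_lt j i.2]

/-- Comparison with the zero flow. A negative noise `ε none` at the root is transferred to the first
vertices of the paths by means of the root inequality; this saves `v / (2π)` per path. -/
theorem exists_bound_of_zero {m l : ℕ} (hl : 0 < l) (v : ℝ≥0)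
    {μ : Option (Fin m × Fin l) → ℝ} (hμ : μ ∈ (spiderTree m l).flows) :
    ∃ g, Integrable g (iidGaussian (Option (Fin m × Fin l)) v) ∧
      (∀ ε, ∑ i, ((spiderTree m l).leastSquares (μ + ε) i - μ i) ^ 2 ≤ g ε) ∧
      ∫ ε, g ε ∂iidGaussian (Option (Fin m × Fin l)) v
        ≤ μ none ^ 2 * (l + 1) + v * (1 / 2 + m * harmonic l / 2 - m / (2 * Real.pi)) := by
  obtain ⟨hroot, hpath⟩ := (mem_flows_spiderTree hl).1 hμ
  have htop0 : ∀ j, 0 ≤ μ (some (j, ⟨0, hl⟩)) := fun j => (hpath j).2 _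
  have hzero : (0 : Option (Fin m × Fin l) → ℝ) ∈ (spiderTree m l).flows := fun i => by simp
  have hbias : ∑ i, ((0 : Option (Fin m × Fin l) → ℝ) i - μ i) ^ 2 ≤ μ none ^ 2 * (l + 1) := by
    have h1 : ∀ j, ∑ i, μ (some (j, i)) ^ 2 ≤ l * μ (some (j, ⟨0, hl⟩)) ^ 2 := fun j =>
      (Finset.sum_le_card_nsmul _ _ (μ (some (j, ⟨0, hl⟩)) ^ 2) fun i _ =>
        pow_le_pow_left₀ ((hpath j).2 i) ((hpath j).1 (Fin.mk_le_mk.2 (Nat.zero_le i))) 2).trans_eq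
        (by simp)
    have h2 : ∑ j, μ (some (j, ⟨0, hl⟩)) ^ 2 ≤ (μ none) ^ 2 :=
      (Finset.sum_sq_le_sq_sum_of_nonneg fun j _ => htop0 j).trans
        (pow_le_pow_left₀ (Finset.sum_nonneg fun j _ => htop0 j) hroot 2)
    simp only [Pi.zero_apply, zero_sub, neg_sq]
    rw [sum_spider]
    have h3 := Finset.sum_le_sum fun j (_ : j ∈ Finset.univ) => h1 j
    rw [← Finset.mul_sum] at h3
    have h4 := mul_le_mul_of_nonneg_left h2 (Nat.cast_nonneg (α := ℝ) l)
    linarith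
  have hne : ∀ j : Fin m, pathVertex j 0 ≠ (none : Option (Fin m × Fin l)) := fun j => by
    rw [pathVertex_of_lt j hl]; simp
  have i1 : Integrable (fun ε : Option (Fin m × Fin l) → ℝ => (max 0 (ε none)) ^ 2)
      (iidGaussian _ v) := integrable_sq_max_zero (measurable_pi_apply _) (integrable_eval_sq v _)
  have i2 : ∀ j : Fin m, Integrable (fun ε : Option (Fin m × Fin l) → ℝ =>
      monotoneEnergy l fun i => ε (pathVertex j i)) (iidGaussian _ v) :=
    fun j => integrable_monotoneEnergy_comp v l _
  have i3 : ∀ j : Fin m, Integrable (fun ε : Option (Fin m × Fin l) → ℝ =>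
      (max 0 (ε (pathVertex j 0))) ^ 2) (iidGaussian _ v) :=
    fun j => integrable_sq_max_zero (measurable_pi_apply _) (integrable_eval_sq v _)
  have i4 : ∀ j : Fin m, Integrable (fun ε : Option (Fin m × Fin l) → ℝ =>
      (max 0 (ε (pathVertex j 0) - max 0 (-ε none))) ^ 2) (iidGaussian _ v) := fun j =>
    (i3 j).mono' (by fun_prop) (Filter.Eventually.of_forall fun ε => by
      rw [Real.norm_of_nonneg (sq_nonneg _)]
      refine pow_le_pow_left₀ (le_max_left _ _) (max_le_max le_rfl ?_) 2
      linarith [le_max_left 0 (-ε none)])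
  have i5 : ∀ j : Fin m, Integrable (fun ε : Option (Fin m × Fin l) → ℝ =>
      (monotoneEnergy l fun i => ε (pathVertex j i))
        + (max 0 (ε (pathVertex j 0) - max 0 (-ε none))) ^ 2 - (max 0 (ε (pathVertex j 0))) ^ 2)
      (iidGaussian _ v) := fun j => ((i2 j).add (i4 j)).sub (i3 j)
  have i6 : Integrable (fun ε : Option (Fin m × Fin l) → ℝ =>
      ∑ j, ((monotoneEnergy l fun i => ε (pathVertex j i))
        + (max 0 (ε (pathVertex j 0) - max 0 (-ε none))) ^ 2 - (max 0 (ε (pathVertex j 0))) ^ 2))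
      (iidGaussian _ v) := integrable_finsetSum _ fun j _ => i5 j
  refine ⟨fun ε => μ none ^ 2 * (l + 1) + ((max 0 (ε none)) ^ 2
      + ∑ j, ((monotoneEnergy l fun i => ε (pathVertex j i))
        + (max 0 (ε (pathVertex j 0) - max 0 (-ε none))) ^ 2 - (max 0 (ε (pathVertex j 0))) ^ 2)),
    (integrable_const _).add (i1.add i6), fun ε => ?_, ?_⟩
  · have hLS := (spiderTree m l).isLeastSquares_leastSquares (μ + ε)
    set f := (spiderTree m l).leastSquares (μ + ε)
    obtain ⟨hfr, hf⟩ := (mem_flows_spiderTree hl).1 hLS.1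
    refine (hLS.oracle hzero).trans (add_le_add hbias ?_)
    simp only [Pi.zero_apply, sub_zero]
    rw [sum_spider]
    set a := max 0 (-ε none) with ha
    have ha0 : 0 ≤ a := le_max_left _ _
    obtain ⟨l, rfl⟩ : ∃ l', l = l' + 1 := ⟨l - 1, by omega⟩
    have hp : ∀ j, ∑ i, (2 * ε (some (j, i)) * f (some (j, i)) - f (some (j, i)) ^ 2)
        ≤ ((monotoneEnergy (l + 1) fun i => ε (pathVertex j i))
          + (max 0 (ε (pathVertex j 0) - a)) ^ 2 - (max 0 (ε (pathVertex j 0))) ^ 2)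
          + 2 * a * f (some (j, ⟨0, hl⟩)) := by
      intro j
      set y : ℕ → ℝ := fun i => if i = 0 then ε (pathVertex j 0) - a else ε (pathVertex j i)
      have h1 := monotoneEnergy_sub_first l (fun i => ε (pathVertex j i)) y ha0 (by simp [y])
        fun i => by simp [y]
      have h2 := quadratic_le_monotoneEnergy (l + 1) y (fun i => f (pathVertex j i))
        (fun i i' hi hi' => by
          rw [pathVertex_of_lt j hi', pathVertex_of_lt j (hi.trans_lt hi')]
          exact (hf j).1 (Fin.mk_le_mk.2 hi))
        fun i hi => by rw [pathVertex_of_lt j hi]; exact (hf j).2 _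
      rw [sum_path (fun i => 2 * ε i * f i - f i ^ 2)]
      rw [Finset.sum_range_succ'] at h2 ⊢
      rw [← pathVertex_of_lt j hl]
      simp only [y, if_pos, Nat.add_eq_zero_iff, one_ne_zero, and_false, if_false] at h1 h2
      linarith
    have hsum := Finset.sum_le_sum fun j (_ : j ∈ Finset.univ) => hp j
    rw [Finset.sum_add_distrib, ← Finset.mul_sum] at hsum
    have hr : 2 * ε none * f none - f none ^ 2 + 2 * a * ∑ j, f (some (j, ⟨0, hl⟩))
        ≤ (max 0 (ε none)) ^ 2 := by
      have h1 := mul_le_mul_of_nonneg_left hfr ha0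
      have h2 : ε none + a = max 0 (ε none) := by
        rw [ha]
        rcases le_total (ε none) 0 with h | h
        · rw [max_eq_left h, max_eq_right (by linarith)]; ring
        · rw [max_eq_right h, max_eq_left (by linarith)]; ring
      rw [← h2]
      nlinarith [sq_nonneg (ε none + a - f none)]
    linarith
  · have i7 : Integrable (fun ε : Option (Fin m × Fin l) → ℝ => (max 0 (ε none)) ^ 2
        + ∑ j, ((monotoneEnergy l fun i => ε (pathVertex j i))
        + (max 0 (ε (pathVertex j 0) - max 0 (-ε none))) ^ 2 - (max 0 (ε (pathVertex j 0))) ^ 2))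
        (iidGaussian _ v) := i1.add i6
    rw [integral_add (integrable_const _) i7, integral_const, probReal_univ, one_smul,
      integral_add i1 i6, integral_sq_eval_max_zero, integral_finsetSum _ fun j _ => i5 j]
    have h1 : ∀ j : Fin m, ∫ ε : Option (Fin m × Fin l) → ℝ,
        ((monotoneEnergy l fun i => ε (pathVertex j i))
        + (max 0 (ε (pathVertex j 0) - max 0 (-ε none))) ^ 2 - (max 0 (ε (pathVertex j 0))) ^ 2)
        ∂iidGaussian _ v = v * (harmonic l : ℝ) / 2 - v / (2 * Real.pi) := by
      intro j
      have e1 := integral_sub ((i2 j).add (i4 j)) (i3 j)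
      have e2 := integral_add (i2 j) (i4 j)
      simp only [Pi.add_apply] at e1
      rw [e1, e2, integral_monotoneEnergy_comp v l _ (injOn_pathVertex j),
        integral_sq_posPart_sub_negPart v (hne j), integral_sq_eval_max_zero]
      ring
    simp only [h1, Finset.sum_const, Finset.card_univ, Fintype.card_fin, nsmul_eq_mul]
    refine le_of_eq ?_
    ring

/-! ### Upper bound through maximal noise sums -/

theorem sum_mul_le_first_mul_prefixMax (n : ℕ) (x h : ℕ → ℝ)
    (hh : ∀ i j, i ≤ j → j < n → h j ≤ h i) (h0 : ∀ i < n, 0 ≤ h i) :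
    ∑ i ∈ Finset.range n, x i * h i ≤ h 0 * prefixMax n x := by
  induction n generalizing x h with
  | zero => simp [prefixMax]
  | succ n ih =>
    have h1 := ih (fun i => x (i + 1)) (fun i => h (i + 1))
      (fun i j hij hj => hh _ _ (by omega) (by omega)) fun i hi => h0 _ (by omega)
    have h2 : h 1 * prefixMax n (fun i => x (i + 1)) ≤ h 0 * prefixMax n fun i => x (i + 1) := by
      rcases n.eq_zero_or_pos with rfl | hn
      · simp [prefixMax]
      · exact mul_le_mul_of_nonneg_right (hh 0 1 zero_le_one (by omega)) (prefixMax_nonneg _ _)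
    have h3 := mul_le_mul_of_nonneg_left
      (le_max_right 0 (x 0 + prefixMax n fun i => x (i + 1))) (h0 0 n.succ_pos)
    rw [Finset.sum_range_succ', prefixMax]
    linarith

theorem exp_prefixMax_le (c : ℝ) (n : ℕ) (x : ℕ → ℝ) :
    Real.exp (c * prefixMax n x)
      ≤ ∑ k ∈ Finset.range (n + 1), Real.exp (c * ∑ i ∈ Finset.range k, x i) := by
  induction n with
  | zero => simp [prefixMax]
  | succ n ih =>
    rw [Finset.sum_range_succ, prefixMax_succ']
    rcases max_cases (prefixMax n x) (∑ i ∈ Finset.range (n + 1), x i) with ⟨e, _⟩ | ⟨e, _⟩ <;>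
      rw [e]
    · linarith [Real.exp_pos (c * ∑ i ∈ Finset.range (n + 1), x i)]
    · linarith [Finset.sum_nonneg fun k (_ : k ∈ Finset.range (n + 1)) =>
        (Real.exp_pos (c * ∑ i ∈ Finset.range k, x i)).le]

/-- A truncation at `K` which makes a second moment accessible to exponential moments. -/
theorem sq_le_two_mul_sq_add_exp {z K : ℝ} (hz : 0 ≤ z) (hK : 0 ≤ K) :
    z ^ 2 ≤ 2 * K ^ 2 + 4 * (Real.exp (-K) * Real.exp z) := by
  rw [← Real.exp_add]
  rcases le_total z K with h | h
  · nlinarith [Real.exp_pos (-K + z)]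
  · have := Real.quadratic_le_exp_of_nonneg (x := -K + z) (by linarith)
    nlinarith [sq_nonneg (z - 2 * K)]

/-- The exponential moments of a sum of `k` distinct noise variables. -/
theorem integrable_exp_sum (v : ℝ≥0) (c : ℝ) {ι : Type*} [Fintype ι] {k : ℕ} {e : ℕ → ι}
    (he : Set.InjOn e (Set.Iio k)) :
    Integrable (fun ε => Real.exp (c * ∑ i ∈ Finset.range k, ε (e i))) (iidGaussian ι v)
    ∧ ∫ ε, Real.exp (c * ∑ i ∈ Finset.range k, ε (e i)) ∂iidGaussian ι v
      = Real.exp (k * (v * c ^ 2 / 2)) := by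
  have hinj : Function.Injective fun i : Fin k => e i := fun a b hab =>
    Fin.ext (he a.2 b.2 hab)
  have hmp := measurePreserving_iidGaussian_comp v hinj
  have hI : Integrable (fun y : Fin k → ℝ => ∏ i, Real.exp (c * y i)) (iidGaussian (Fin k) v) :=
    Integrable.fintype_prod (f := fun _ x => Real.exp (c * x))
      fun i => integrable_exp_mul_gaussianReal c
  have heq : ∀ ε : ι → ℝ, Real.exp (c * ∑ i ∈ Finset.range k, ε (e i))
      = ∏ i : Fin k, Real.exp (c * ε (e i)) := fun ε => by
    rw [Finset.sum_range, Finset.mul_sum, Real.exp_sum]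
  simp only [heq]
  refine ⟨hmp.integrable_comp_of_integrable hI, ?_⟩
  rw [integral_comp_of_measurePreserving hmp (f := fun y : Fin k → ℝ => ∏ i, Real.exp (c * y i))
    (by fun_prop), integral_fintype_prod_eq_prod (fun _ x => Real.exp (c * x))]
  have hm := congrFun (mgf_fun_id_gaussianReal (μ := 0) (v := v)) c
  rw [mgf, zero_mul, zero_add] at hm
  simp only [hm, Finset.prod_const, Finset.card_univ, Fintype.card_fin]
  rw [← Real.exp_nat_mul]

/-- The squared error is at most the squared noise. -/
theorem exists_bound_of_noise {ι : Type*} [Fintype ι] [DecidableEq ι] (T : ParentTree ι) (v : ℝ≥0)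
    {μ : ι → ℝ} (hμ : μ ∈ T.flows) :
    ∃ g, Integrable g (iidGaussian ι v) ∧
      (∀ ε, ∑ i, (T.leastSquares (μ + ε) i - μ i) ^ 2 ≤ g ε) ∧
      ∫ ε, g ε ∂iidGaussian ι v = Fintype.card ι * v := by
  refine ⟨fun ε => ∑ i, ε i ^ 2, integrable_finsetSum _ fun i _ => integrable_eval_sq v i,
    fun ε => ?_, ?_⟩
  · refine ((T.isLeastSquares_leastSquares (μ + ε)).oracle hμ).trans ?_
    simp only [sub_self, zero_pow two_ne_zero, Finset.sum_const_zero, zero_add]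
    exact Finset.sum_le_sum fun i _ => by
      nlinarith [sq_nonneg (ε i - (T.leastSquares (μ + ε) i - μ i))]
  · rw [integral_finsetSum _ fun i _ => integrable_eval_sq v i]
    simp [integral_eval_sq]

/-- A flow is a combination, of total weight its root value, of indicators of initial segments of
paths joined with the root; its correlation with the noise is thus at most the root value times the
largest noise sum along such a segment. -/
theorem sum_mul_flow_le {m l : ℕ} (hl : 0 < l) {f ε : Option (Fin m × Fin l) → ℝ}
    (hf : f ∈ (spiderTree m l).flows) {Z : ℝ} (hZ0 : 0 ≤ Z)
    (hZ : ∀ j, prefixMax l (fun i => ε (pathVertex j i)) ≤ Z) :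
    ∑ i, ε i * f i ≤ f none * (|ε none| + Z) := by
  obtain ⟨hroot, hpath⟩ := (mem_flows_spiderTree hl).1 hf
  rw [sum_spider]
  have h1 : ∀ j, ∑ i, ε (some (j, i)) * f (some (j, i)) ≤ f (some (j, ⟨0, hl⟩)) * Z := by
    intro j
    have h2 := sum_mul_le_first_mul_prefixMax l (fun i => ε (pathVertex j i))
      (fun i => f (pathVertex j i)) (fun i i' hi hi' => by
          rw [pathVertex_of_lt j hi', pathVertex_of_lt j (hi.trans_lt hi')]
          exact (hpath j).1 (Fin.mk_le_mk.2 hi))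
      fun i hi => by rw [pathVertex_of_lt j hi]; exact (hpath j).2 _
    rw [← sum_path (fun i => ε i * f i), pathVertex_of_lt j hl] at h2
    exact h2.trans (mul_le_mul_of_nonneg_left (hZ j) ((hpath j).2 _))
  have h2 := Finset.sum_le_sum fun j (_ : j ∈ Finset.univ) => h1 j
  rw [← Finset.sum_mul] at h2
  have h3 := mul_le_mul_of_nonneg_right hroot hZ0
  have h4 : 0 ≤ f none := (Finset.sum_nonneg fun j _ => (hpath j).2 _).trans hroot
  have h5 := mul_le_mul_of_nonneg_left (le_abs_self (ε none)) h4
  linarith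

/-- Comparison through the maximal noise sum along initial segments of paths, `τ² = v l` being the
scale of these sums. -/
theorem exists_bound_of_prefixMax {m l : ℕ} (hl : 0 < l) (v : ℝ≥0) {V τ K A : ℝ}
    (hV : 0 ≤ V) (hτ : 0 < τ) (hτv : τ ^ 2 = v * l) (hK : 0 ≤ K) (hA : 0 < A)
    {μ : Option (Fin m × Fin l) → ℝ} (hμ : μ ∈ (spiderTree m l).flows) (hμV : μ none ≤ V) :
    ∃ g, Integrable g (iidGaussian (Option (Fin m × Fin l)) v) ∧
      (∀ ε, ∑ i, ((spiderTree m l).leastSquares (μ + ε) i - μ i) ^ 2 ≤ g ε) ∧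
      ∫ ε, g ε ∂iidGaussian (Option (Fin m × Fin l)) v
        ≤ V * ((2 * v + 2 * (v * l) * (2 * K ^ 2
            + 4 * (Real.exp (-K) * (m * ((l + 1) * Real.exp (1 / 2)))))) / A + A)
          + (2 * v + 2 * (v * l) * (2 * K ^ 2
            + 4 * (Real.exp (-K) * (m * ((l + 1) * Real.exp (1 / 2)))))) := by
  set X : (Option (Fin m × Fin l) → ℝ) → ℝ := fun ε => ∑ j, ∑ k ∈ Finset.range (l + 1),
    Real.exp (τ⁻¹ * ∑ i ∈ Finset.range k, ε (pathVertex j i)) with hX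
  set P : (Option (Fin m × Fin l) → ℝ) → ℝ := fun ε =>
    2 * K ^ 2 + 4 * (Real.exp (-K) * X ε) with hP
  set S : (Option (Fin m × Fin l) → ℝ) → ℝ := fun ε =>
    2 * ε none ^ 2 + 2 * (v * l) * P ε with hS
  have hX0 : ∀ ε, 0 ≤ X ε := fun ε => Finset.sum_nonneg fun j _ => Finset.sum_nonneg fun k _ =>
    (Real.exp_pos _).le
  have hP0 : ∀ ε, 0 ≤ P ε := fun ε => by have := hX0 ε; positivity
  have hS0 : ∀ ε, 0 ≤ S ε := fun ε => by have := hP0 ε; positivity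
  have hinj : ∀ (j : Fin m) (k : ℕ), k ∈ Finset.range (l + 1) →
      Set.InjOn (pathVertex (l := l) j) (Set.Iio k) := fun j k hk =>
    (injOn_pathVertex j).mono (Set.Iio_subset_Iio (Nat.lt_succ_iff.1 (Finset.mem_range.1 hk)))
  have iX : Integrable X (iidGaussian _ v) := integrable_finsetSum _ fun j _ =>
    integrable_finsetSum _ fun k hk => (integrable_exp_sum v τ⁻¹ (hinj j k hk)).1
  have iP : Integrable P (iidGaussian _ v) :=
    (integrable_const _).add ((iX.const_mul _).const_mul _)
  have iN := integrable_eval_sq v (none : Option (Fin m × Fin l))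
  have iS : Integrable S (iidGaussian _ v) := (iN.const_mul _).add (iP.const_mul _)
  have iC : Integrable (fun ε : Option (Fin m × Fin l) → ℝ => ∑ i, ε i * μ i) (iidGaussian _ v) :=
    integrable_finsetSum _ fun i _ => (integrable_iidGaussian_eval v i).mul_const _
  have iT : Integrable (fun ε => V * (S ε / A + A)) (iidGaussian _ v) :=
    ((iS.div_const A).add (integrable_const A)).const_mul V
  have iTS : Integrable (fun ε => V * (S ε / A + A) + S ε) (iidGaussian _ v) := iT.add iS
  refine ⟨fun ε => V * (S ε / A + A) + S ε - 2 * ∑ i, ε i * μ i, iTS.sub (iC.const_mul 2),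
    fun ε => ?_, ?_⟩
  · have hLS := (spiderTree m l).isLeastSquares_leastSquares (μ + ε)
    set f := (spiderTree m l).leastSquares (μ + ε)
    set D := √(∑ i, (f i - μ i) ^ 2) with hD
    set R := √(S ε) with hR
    have hD2 : D ^ 2 = ∑ i, (f i - μ i) ^ 2 :=
      Real.sq_sqrt (Finset.sum_nonneg fun i _ => sq_nonneg _)
    have hR2 : R ^ 2 = S ε := Real.sq_sqrt (hS0 ε)
    have hR0 : 0 ≤ R := Real.sqrt_nonneg _
    have hZ : ∀ j, prefixMax l (fun i => ε (pathVertex j i)) ≤ τ * √(P ε) := by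
      intro j
      rw [← div_le_iff₀' hτ]
      refine Real.le_sqrt_of_sq_le ?_
      have h1 := exp_prefixMax_le τ⁻¹ l fun i => ε (pathVertex j i)
      have h2 : _ ≤ X ε := Finset.single_le_sum (f := fun j => ∑ k ∈ Finset.range (l + 1),
          Real.exp (τ⁻¹ * ∑ i ∈ Finset.range k, ε (pathVertex j i)))
        (fun j _ => Finset.sum_nonneg fun k _ => (Real.exp_pos _).le) (Finset.mem_univ j)
      have h3 := sq_le_two_mul_sq_add_exp
        (mul_nonneg (inv_nonneg.2 hτ.le) (prefixMax_nonneg l fun i => ε (pathVertex j i))) hK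
      have h4 := mul_le_mul_of_nonneg_left (h1.trans h2) (Real.exp_pos (-K)).le
      rw [div_eq_inv_mul]
      simp only [hP]
      linarith
    have hRle : |ε none| + τ * √(P ε) ≤ R := by
      refine Real.le_sqrt_of_sq_le ?_
      have h1 : (τ * √(P ε)) ^ 2 = v * l * P ε := by
        rw [mul_pow, Real.sq_sqrt (hP0 ε), hτv]
      have h2 := sq_abs (ε none)
      simp only [hS]
      nlinarith [sq_nonneg (|ε none| - τ * √(P ε))]
    have hfr : f none ≤ V + D := by
      have h1 : f none - μ none ≤ D := by
        refine Real.le_sqrt_of_sq_le ?_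
        exact Finset.single_le_sum (f := fun i => (f i - μ i) ^ 2) (fun i _ => sq_nonneg _)
          (Finset.mem_univ none)
      linarith
    obtain ⟨hfroot, hfpath⟩ := (mem_flows_spiderTree hl).1 hLS.1
    have hcor := sum_mul_flow_le hl hLS.1 (ε := ε)
      (mul_nonneg hτ.le (Real.sqrt_nonneg _)) hZ
    have hf0 : 0 ≤ f none := (Finset.sum_nonneg fun j _ => (hfpath j).2 _).trans hfroot
    have h1 : ∑ i, ε i * f i ≤ (V + D) * R :=
      hcor.trans (mul_le_mul hfr hRle (by positivity) (by positivity))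
    have h2 := hLS.oracle hμ
    simp only [sub_self, zero_pow two_ne_zero, Finset.sum_const_zero, zero_add,
      Finset.sum_sub_distrib] at h2
    have h3 : ∑ i, 2 * ε i * (f i - μ i) = 2 * ∑ i, ε i * f i - 2 * ∑ i, ε i * μ i := by
      rw [Finset.mul_sum, Finset.mul_sum, ← Finset.sum_sub_distrib]
      exact Finset.sum_congr rfl fun i _ => by ring
    have h4 : 2 * R ≤ S ε / A + A := by
      rw [← hR2, ← sub_le_iff_le_add, le_div_iff₀ hA]
      nlinarith [sq_nonneg (R - A)]
    have h5 := mul_le_mul_of_nonneg_left h4 hV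
    rw [h3, ← hD2] at h2
    rw [← hD2]
    nlinarith [sq_nonneg (D - R)]
  · have eX : ∫ ε, X ε ∂iidGaussian _ v ≤ m * ((l + 1) * Real.exp (1 / 2)) := by
      simp only [hX]
      rw [integral_finsetSum _ fun j _ => integrable_finsetSum _ fun k hk =>
        (integrable_exp_sum v τ⁻¹ (hinj j k hk)).1]
      refine (Finset.sum_le_card_nsmul _ _ ((l + 1) * Real.exp (1 / 2)) fun j _ => ?_).trans_eq
        (by simp)
      rw [integral_finsetSum _ fun k hk => (integrable_exp_sum v τ⁻¹ (hinj j k hk)).1]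
      refine (Finset.sum_le_card_nsmul _ _ (Real.exp (1 / 2)) fun k hk => ?_).trans_eq (by simp)
      rw [(integrable_exp_sum v τ⁻¹ (hinj j k hk)).2, Real.exp_le_exp]
      have hk' : (k : ℝ) ≤ l := by
        exact_mod_cast Nat.lt_succ_iff.1 (Finset.mem_range.1 hk)
      have h1 : (l : ℝ) * (v * τ⁻¹ ^ 2 / 2) = 1 / 2 := by
        have : (v : ℝ) * l * τ⁻¹ ^ 2 = 1 := by
          rw [← hτv, ← mul_pow, mul_inv_cancel₀ hτ.ne', one_pow]
        linarith
      rw [← h1]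
      gcongr
    have eP : ∫ ε, P ε ∂iidGaussian _ v
        = 2 * K ^ 2 + 4 * (Real.exp (-K) * ∫ ε, X ε ∂iidGaussian _ v) := by
      simp only [hP]
      rw [integral_add (integrable_const _) ((iX.const_mul _).const_mul _), integral_const,
        probReal_univ, one_smul, integral_const_mul, integral_const_mul]
    have eS : ∫ ε, S ε ∂iidGaussian _ v = 2 * v + 2 * (v * l) * ∫ ε, P ε ∂iidGaussian _ v := by
      simp only [hS]
      rw [integral_add (iN.const_mul _) (iP.const_mul _), integral_const_mul, integral_const_mul,
        integral_eval_sq]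
    have eC : ∫ ε : Option (Fin m × Fin l) → ℝ, ∑ i, ε i * μ i ∂iidGaussian _ v = 0 := by
      rw [integral_finsetSum _ fun i _ => (integrable_iidGaussian_eval v i).mul_const _]
      simp [integral_mul_const, integral_iidGaussian_eval]
    have eT : ∫ ε, V * (S ε / A + A) ∂iidGaussian _ v
        = V * ((∫ ε, S ε ∂iidGaussian _ v) / A + A) := by
      rw [integral_const_mul, integral_add (iS.div_const A) (integrable_const A), integral_div,
        integral_const, probReal_univ, one_smul]
    rw [integral_sub iTS (iC.const_mul 2), integral_add iT iS, eT, integral_const_mul, eC,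
      mul_zero, sub_zero, eS, eP]
    have hexp := (Real.exp_pos (-K)).le
    gcongr

/-! ### Optimization of the bounds -/

/-- The gap `1 + log n - H n` increases with `n`; it is used from its value at `n = 2` on. -/
theorem harmonic_le_one_add_log_sub {n : ℕ} (hn : 2 ≤ n) :
    (harmonic n : ℝ) ≤ 1 + Real.log n - (Real.log 2 - 1 / 2) := by
  induction n, hn using Nat.le_induction with
  | base =>
    have : harmonic 2 = 3 / 2 := by norm_num [harmonic, Finset.sum_range_succ]
    rw [this]; push_cast; linarith
  | succ n hn ih =>
    have hn0 : (0 : ℝ) < n := by positivity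
    have h1 := Real.one_sub_inv_le_log_of_pos (x := ((n : ℝ) + 1) / n) (by positivity)
    rw [Real.log_div (by positivity) (by positivity)] at h1
    have h2 : 1 - (((n : ℝ) + 1) / n)⁻¹ = ((n : ℝ) + 1)⁻¹ := by field_simp; ring
    rw [harmonic_succ]
    push_cast
    linarith

/-- The cost of `⌊s⌋` nonzero levels against the approximation error. -/
theorem cube_div_add_floor_le {s : ℝ} (hs : 0 ≤ s) :
    s ^ 3 / (2 * (⌊s⌋₊ : ℝ) + 1) ^ 2 + ⌊s⌋₊ ≤ 5 / 4 * s := by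
  have h1 := Nat.floor_le hs
  have h2 := Nat.lt_floor_add_one s
  have hk : (0 : ℝ) ≤ ⌊s⌋₊ := Nat.cast_nonneg _
  generalize (⌊s⌋₊ : ℝ) = k at *
  obtain ⟨t, rfl⟩ : ∃ t, s = k + t := ⟨s - k, by ring⟩
  have ht0 : 0 ≤ t := by linarith
  have ht1 : 0 ≤ 1 - t := by linarith
  have h3 : (k + t) ^ 3 / (2 * k + 1) ^ 2 ≤ 5 / 4 * (k + t) - k := by
    rw [div_le_iff₀ (by positivity)]
    -- both sides are compared along the chord from `t = 0` to `t = 1`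
    have e : (5 / 4 * (k + t) - k) * (2 * k + 1) ^ 2 - (k + t) ^ 3
        = (1 - t) * (k ^ 2 + k / 4) + t * (3 * k ^ 2 + 9 / 4 * k + 1 / 4)
          + t * (1 - t) * (3 * k + 1 + t) := by ring
    have : 0 ≤ (1 - t) * (k ^ 2 + k / 4) + t * (3 * k ^ 2 + 9 / 4 * k + 1 / 4)
          + t * (1 - t) * (3 * k + 1 + t) := by positivity
    linarith
  linarith

/-- The power mean inequality between the exponents `2` and `3`. -/
theorem sum_sq_pow_three_le {m : ℕ} {r : Fin m → ℝ} (hr : ∀ j, 0 ≤ r j) :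
    (∑ j, r j ^ 2) ^ 3 ≤ m * (∑ j, r j ^ 3) ^ 2 := by
  have hA : 0 ≤ ∑ j, r j ^ 2 := Finset.sum_nonneg fun j _ => sq_nonneg _
  have h1 : (∑ j, r j ^ 2) ^ 2 ≤ (∑ j, r j) * ∑ j, r j ^ 3 :=
    Finset.sum_sq_le_sum_mul_sum_of_sq_le_mul _ (fun j _ => hr j) (fun j _ => pow_nonneg (hr j) 3)
      fun j _ => le_of_eq (by ring)
  have h2 : (∑ j, r j) ^ 2 ≤ m * ∑ j, r j ^ 2 := by
    simpa using sq_sum_le_card_mul_sum_sq (s := (Finset.univ : Finset (Fin m))) (f := r)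
  have h3 : ((∑ j, r j ^ 2) ^ 2) ^ 2 ≤ ((∑ j, r j) * ∑ j, r j ^ 3) ^ 2 :=
    pow_le_pow_left₀ (sq_nonneg _) h1 2
  have h4 := mul_le_mul_of_nonneg_right h2 (sq_nonneg (∑ j, r j ^ 3))
  rcases hA.eq_or_lt with h0 | h0
  · rw [← h0, zero_pow three_ne_zero]; positivity
  · refine le_of_mul_le_mul_left ?_ h0
    nlinarith

/-- The bound of `exists_bound_of_levels` for the best choice of the numbers of levels. -/
theorem exists_levels {m l : ℕ} {n : ℕ} (hml : (m * l : ℝ) ≤ 2 * n) {v L V s H : ℝ} (hv : 0 < v)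
    (hL : 0 < L) (hs0 : 0 ≤ s) (hs : s ^ 3 * (v * L) = n * V ^ 2) (hHL : H ≤ L)
    {a : Fin m → ℝ} (ha : ∀ j, 0 ≤ a j) (haV : ∑ j, a j ≤ V) :
    ∃ k : Fin m → ℕ, ∑ j, l * (a j / (2 * k j + 1)) ^ 2
      + v * (1 + m * H / 2 + H * ∑ j, (k j : ℝ)) ≤ v * (1 + m * H / 2 + 63 / 40 * s * L) := by
  have hvL : 0 < v * L := mul_pos hv hL
  have hc0 : (0 : ℝ) ≤ l / (v * L) := by positivity
  -- the number `r j ^ 2` is the cube root of `l (a j)² / (v L)`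
  set r : Fin m → ℝ := fun j => (√(l / (v * L)) * a j) ^ (1 / 3 : ℝ) with hr
  have hr0 : ∀ j, 0 ≤ r j := fun j => by have := ha j; positivity
  have hr3 : ∀ j, r j ^ 3 = √(l / (v * L)) * a j := fun j => by
    rw [hr, ← Real.rpow_natCast, ← Real.rpow_mul (by have := ha j; positivity)]
    norm_num
  have hr6 : ∀ j, l * a j ^ 2 = v * L * (r j ^ 2) ^ 3 := fun j => by
    have : (r j ^ 2) ^ 3 = (r j ^ 3) ^ 2 := by ring
    rw [this, hr3, mul_pow, Real.sq_sqrt hc0]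
    field_simp
  have hsum : ∑ j, r j ^ 2 ≤ 63 / 50 * s := by
    have h1 := sum_sq_pow_three_le hr0
    simp only [hr3, ← Finset.mul_sum] at h1
    rw [mul_pow, Real.sq_sqrt hc0] at h1
    have h2 : (∑ j, a j) ^ 2 ≤ V ^ 2 :=
      pow_le_pow_left₀ (Finset.sum_nonneg fun j _ => ha j) haV 2
    have h3 : m * (l / (v * L) * (∑ j, a j) ^ 2) ≤ 2 * s ^ 3 := by
      have e1 : m * (l / (v * L) * (∑ j, a j) ^ 2) = (m * l) * (∑ j, a j) ^ 2 / (v * L) := by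
        ring
      rw [e1, div_le_iff₀ hvL]
      calc _ ≤ (2 * n : ℝ) * V ^ 2 := by gcongr
        _ = _ := by rw [mul_assoc, mul_assoc, hs]
    -- `63 / 50` exceeds the cube root of `2`
    refine (pow_le_pow_iff_left₀ (Finset.sum_nonneg fun j _ => sq_nonneg _) (by positivity)
      three_ne_zero).1 (h1.trans (h3.trans ?_))
    nlinarith [pow_nonneg hs0 3]
  refine ⟨fun j => ⌊r j ^ 2⌋₊, ?_⟩
  have h1 : ∀ j, l * (a j / (2 * (⌊r j ^ 2⌋₊ : ℝ) + 1)) ^ 2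
      = v * L * ((r j ^ 2) ^ 3 / (2 * (⌊r j ^ 2⌋₊ : ℝ) + 1) ^ 2) := fun j => by
    rw [div_pow, ← mul_div_assoc, hr6, mul_div_assoc]
  have h2 : ∑ j, ((r j ^ 2) ^ 3 / (2 * (⌊r j ^ 2⌋₊ : ℝ) + 1) ^ 2 + (⌊r j ^ 2⌋₊ : ℝ))
      ≤ ∑ j, 5 / 4 * r j ^ 2 := Finset.sum_le_sum fun j _ => cube_div_add_floor_le (sq_nonneg _)
  rw [← Finset.mul_sum, Finset.sum_add_distrib] at h2
  simp only [h1, ← Finset.mul_sum]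
  have h3 : H * ∑ j, (⌊r j ^ 2⌋₊ : ℝ) ≤ L * ∑ j, (⌊r j ^ 2⌋₊ : ℝ) :=
    mul_le_mul_of_nonneg_right hHL (Finset.sum_nonneg fun j _ => Nat.cast_nonneg _)
  have h4 := mul_le_mul_of_nonneg_left
    (h2.trans (mul_le_mul_of_nonneg_left hsum (by norm_num))) hL.le
  have h5 := mul_le_mul_of_nonneg_left h3 hv.le
  have h6 := mul_le_mul_of_nonneg_left h4 hv.le
  linarith

section shape

variable {n : ℕ} {α : ℝ}

theorem log_exp_one_mul (hn : 1 ≤ n) : Real.log (Real.exp 1 * n) = 1 + Real.log n := by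
  rw [Real.log_mul (Real.exp_ne_zero _) (by positivity), Real.log_exp]

theorem rpow_one_sub_eq (hn : 1 ≤ n) : (n : ℝ) ^ (1 - α) = n / (n : ℝ) ^ α := by
  rw [Real.rpow_sub (by positivity), Real.rpow_one]

theorem ceil_rpow_one_sub_le (hn : 1 ≤ n) (h0 : 0 < α) : ⌈(n : ℝ) ^ (1 - α)⌉₊ ≤ n := by
  rw [Nat.ceil_le, rpow_one_sub_eq hn]
  exact div_le_self (by positivity) (Real.one_le_rpow (by exact_mod_cast hn) h0.le)

/-- Either the tree has two paths below the root, or `n ^ α > 2`, and then `n` is large. -/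
theorem ceil_rpow_cases (hn : 2 ≤ n) (h0 : 0 < α) (h1 : α ≤ 1 / 3) :
    ⌈(n : ℝ) ^ α⌉₊ = 2 ∨ (2 < (n : ℝ) ^ α ∧ ((n : ℝ) ^ α) ^ 3 ≤ n
      ∧ (⌈(n : ℝ) ^ α⌉₊ : ℝ) < (n : ℝ) ^ α + 1) := by
  have hn1 : (1 : ℝ) < n := by exact_mod_cast hn
  have hx1 : 1 < (n : ℝ) ^ α := Real.one_lt_rpow hn1 h0
  rcases le_or_gt ((n : ℝ) ^ α) 2 with h | h
  · left
    rw [Nat.ceil_eq_iff two_ne_zero]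
    exact ⟨by norm_num; exact hx1, by exact_mod_cast h⟩
  · refine Or.inr ⟨h, ?_, Nat.ceil_lt_add_one (by positivity)⟩
    rw [← Real.rpow_natCast, ← Real.rpow_mul (by positivity)]
    calc (n : ℝ) ^ (α * (3 : ℕ)) ≤ (n : ℝ) ^ (1 : ℝ) :=
          Real.rpow_le_rpow_of_exponent_le hn1.le (by push_cast; linarith)
      _ = n := Real.rpow_one _

theorem ceil_mul_ceil_le (hn : 2 ≤ n) (h0 : 0 < α) (h1 : α ≤ 1 / 3) :
    (⌈(n : ℝ) ^ α⌉₊ * ⌈(n : ℝ) ^ (1 - α)⌉₊ : ℝ) ≤ 2 * n := by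
  rcases ceil_rpow_cases hn h0 h1 with h | ⟨hx, hx3, hm⟩
  · rw [h]
    have : (⌈(n : ℝ) ^ (1 - α)⌉₊ : ℝ) ≤ n := by
      exact_mod_cast ceil_rpow_one_sub_le (by omega) h0
    push_cast
    linarith
  · have hl := Nat.ceil_lt_add_one (a := (n : ℝ) ^ (1 - α)) (by positivity)
    rw [rpow_one_sub_eq (α := α) (by omega : 1 ≤ n)] at hl ⊢
    set x := (n : ℝ) ^ α
    have hx0 : 0 < x := by linarith
    have h2 : (n : ℝ) / x ≤ n / 2 := div_le_div_of_nonneg_left (by positivity) two_pos hx.le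
    have h3 : x * (n / x) = n := by field_simp
    have h4 : 4 * x ≤ n := by
      nlinarith [mul_pos hx0 (mul_pos (sub_pos.2 hx) (by linarith : 0 < x + 2))]
    calc (⌈x⌉₊ * ⌈(n : ℝ) / x⌉₊ : ℝ) ≤ (x + 1) * (n / x + 1) := by gcongr
      _ = n + x + n / x + 1 := by linear_combination h3
      _ ≤ 2 * n := by linarith

/-- From three paths on there is room for a free root value. -/
theorem three_paths_bound (hn : 2 ≤ n) (h0 : 0 < α) (hx : 2 < (n : ℝ) ^ α)
    (hx3 : ((n : ℝ) ^ α) ^ 3 ≤ n) (hm : (⌈(n : ℝ) ^ α⌉₊ : ℝ) < (n : ℝ) ^ α + 1) :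
    1 + ⌈(n : ℝ) ^ α⌉₊ * (harmonic ⌈(n : ℝ) ^ (1 - α)⌉₊ : ℝ) / 2
      ≤ (n : ℝ) ^ α * (1 + Real.log n) := by
  have hH := (harmonic_cast_mono (ceil_rpow_one_sub_le (by omega : 1 ≤ n) h0)).trans
    (harmonic_le_one_add_log n)
  have hH0 := harmonic_cast_nonneg ⌈(n : ℝ) ^ (1 - α)⌉₊
  set x := (n : ℝ) ^ α
  have h8 : (8 : ℝ) ≤ n := by nlinarith [mul_pos (by linarith : 0 < x) (by linarith : 0 < x)]
  have hlog : 1 ≤ Real.log n := by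
    rw [Real.le_log_iff_exp_le (by linarith)]
    linarith [Real.exp_one_lt_d9]
  have h2 : (⌈x⌉₊ : ℝ) * (harmonic ⌈(n : ℝ) ^ (1 - α)⌉₊ : ℝ) ≤ (x + 1) * (1 + Real.log n) :=
    mul_le_mul hm.le hH hH0 (by linarith)
  nlinarith

/-- The base cost with a free root value exceeds the target by at most `12/25 · L`. -/
theorem shape_bound_root (hn : 2 ≤ n) (h0 : 0 < α) (h1 : α ≤ 1 / 3) :
    1 + ⌈(n : ℝ) ^ α⌉₊ * (harmonic ⌈(n : ℝ) ^ (1 - α)⌉₊ : ℝ) / 2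
      ≤ (n : ℝ) ^ α * (1 + Real.log n) + 12 / 25 * (1 + Real.log n) := by
  have hn2 : Real.log 2 ≤ Real.log n := Real.log_le_log two_pos (by exact_mod_cast hn)
  have hlog2 := Real.log_two_gt_d9
  rcases ceil_rpow_cases hn h0 h1 with h | ⟨hx, hx3, hm⟩
  · have hH := (harmonic_cast_mono (ceil_rpow_one_sub_le (by omega : 1 ≤ n) h0)).trans
      (harmonic_le_one_add_log_sub hn)
    have hx1 : 1 ≤ (n : ℝ) ^ α := Real.one_le_rpow (by exact_mod_cast (by omega : 1 ≤ n)) h0.le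
    have h2 := mul_le_mul_of_nonneg_right hx1 (by linarith : 0 ≤ 1 + Real.log n)
    rw [h]
    push_cast
    linarith
  · have := three_paths_bound hn h0 hx hx3 hm
    linarith

/-- For two paths the inequality rests on `log 2 + 1 / π > 1`. -/
theorem shape_bound_zero (hn : 1 ≤ n) (h0 : 0 < α) (h1 : α ≤ 1 / 3) :
    1 / 2 + ⌈(n : ℝ) ^ α⌉₊ * (harmonic ⌈(n : ℝ) ^ (1 - α)⌉₊ : ℝ) / 2
      - ⌈(n : ℝ) ^ α⌉₊ / (2 * Real.pi) ≤ (n : ℝ) ^ α * (1 + Real.log n) := by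
  have hpi : 0 ≤ (⌈(n : ℝ) ^ α⌉₊ : ℝ) / (2 * Real.pi) := by positivity
  rcases hn.eq_or_lt with rfl | hn
  · have hh : harmonic 1 = 1 := by norm_num [harmonic]
    simp only [Nat.cast_one, Real.one_rpow, Nat.ceil_one, hh, Real.log_one] at *
    norm_num at *
    positivity
  rcases ceil_rpow_cases hn h0 h1 with h | ⟨hx, hx3, hm⟩
  · have hH := (harmonic_cast_mono (ceil_rpow_one_sub_le (by omega : 1 ≤ n) h0)).trans
      (harmonic_le_one_add_log_sub hn)
    have hn2 : Real.log 2 ≤ Real.log n := Real.log_le_log two_pos (by exact_mod_cast hn)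
    have hlog2 := Real.log_two_gt_d9
    have hx1 : 1 ≤ (n : ℝ) ^ α := Real.one_le_rpow (by exact_mod_cast (by omega : 1 ≤ n)) h0.le
    have h2 := mul_le_mul_of_nonneg_right hx1 (by linarith : 0 ≤ 1 + Real.log n)
    have h3 : 100 / 315 ≤ 1 / Real.pi := by
      rw [div_le_div_iff₀ (by norm_num) Real.pi_pos]
      linarith [Real.pi_lt_d2]
    rw [h]
    push_cast
    have h4 : (2 : ℝ) / (2 * Real.pi) = 1 / Real.pi := by field_simp
    rw [h4]
    linarith
  · have := three_paths_bound hn h0 hx hx3 hm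
    linarith

end shape

/-! ### The risk on the deep trees -/

theorem rpow_two_thirds_pow_three {y : ℝ} (hy : 0 ≤ y) : (y ^ (2 / 3 : ℝ)) ^ 3 = y ^ 2 := by
  rw [← Real.rpow_natCast, ← Real.rpow_mul hy, ← Real.rpow_natCast]
  norm_num

/-- The bound on the summed squared error for thin trees. The term `n (v V L / n)^(2/3)`, with
`L = log (e n)`, equals `s v L` for the parameter `s` with `s³ = n V² / (v L)`. -/
theorem exists_bound_of_le_one_third {n : ℕ} {α V : ℝ} (v : ℝ≥0) (hn : 1 ≤ n) (h0 : 0 < α)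
    (h1 : α ≤ 1 / 3) (hV : 0 ≤ V) : ∀ μ ∈ (deepTree α n).flows, μ none ≤ V →
    ∃ g, Integrable g (iidGaussian _ v) ∧
      (∀ ε, ∑ i, ((deepTree α n).leastSquares (μ + ε) i - μ i) ^ 2 ≤ g ε) ∧
      ∫ ε, g ε ∂iidGaussian _ v
        ≤ v * ((n : ℝ) ^ α * (1 + Real.log n))
          + 2 * (n * (v * V * (1 + Real.log n) / n) ^ (2 / 3 : ℝ)) := by
  have hn0 : (1 : ℝ) ≤ n := by exact_mod_cast hn
  have hL1 : 1 ≤ 1 + Real.log n := by linarith [Real.log_nonneg hn0]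
  have hl : 0 < ⌈(n : ℝ) ^ (1 - α)⌉₊ := Nat.ceil_pos.2 (by positivity)
  have hln := ceil_rpow_one_sub_le hn h0
  have hzero := shape_bound_zero hn h0 h1
  have hcase : 2 ≤ n ∨ n = 1 := by omega
  have hmlroot : 2 ≤ n → _ := fun h =>
    And.intro (ceil_mul_ceil_le h h0 h1) (shape_bound_root h h0 h1)
  have hone : n = 1 → ⌈(n : ℝ) ^ α⌉₊ = 1 ∧ ⌈(n : ℝ) ^ (1 - α)⌉₊ = 1 := by rintro rfl; simp
  have hx0 : 1 ≤ (n : ℝ) ^ α := Real.one_le_rpow hn0 h0.le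
  unfold deepTree at *
  set L := 1 + Real.log n with hL
  set x := (n : ℝ) ^ α with hx
  generalize ⌈x⌉₊ = m at *
  generalize ⌈(n : ℝ) ^ (1 - α)⌉₊ = l at *
  intro μ hμ hμV
  set T := n * (v * V * L / n) ^ (2 / 3 : ℝ) with hT
  have hv0 : (0 : ℝ) ≤ v := v.2
  have hT0 : 0 ≤ T := by positivity
  rcases hv0.eq_or_lt with hv | hv
  · obtain ⟨g, hg1, hg2, hg3⟩ := exists_bound_of_noise (spiderTree m l) v hμ
    refine ⟨g, hg1, hg2, ?_⟩
    rw [hg3, ← hv]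
    simpa using hT0
  have hL0 : 0 < L := by linarith
  have hvL : 0 < v * L := mul_pos hv hL0
  set s := T / (v * L) with hs
  have hs0 : 0 ≤ s := by positivity
  have hTs : T = s * (v * L) := (div_mul_cancel₀ _ hvL.ne').symm
  have hs3 : s ^ 3 * (v * L) = n * V ^ 2 := by
    rw [hs, div_pow, hT, mul_pow, rpow_two_thirds_pow_three (by positivity)]
    field_simp
  obtain ⟨hroot, hpath⟩ := (mem_flows_spiderTree hl).1 hμ
  have hμ0 : 0 ≤ μ none := (Finset.sum_nonneg fun j _ => (hpath j).2 _).trans hroot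
  have hμ2 : μ none ^ 2 ≤ V ^ 2 := pow_le_pow_left₀ hμ0 hμV 2
  -- for small `s` the zero flow suffices as comparison
  have hsmall : V ^ 2 * (l + 1) ≤ 2 * s * (v * L) → ∃ g, Integrable g (iidGaussian _ v) ∧
      (∀ ε, ∑ i, ((spiderTree m l).leastSquares (μ + ε) i - μ i) ^ 2 ≤ g ε) ∧
      ∫ ε, g ε ∂iidGaussian _ v ≤ v * (x * L) + 2 * T := by
    intro h
    obtain ⟨g, hg1, hg2, hg3⟩ := exists_bound_of_zero hl v hμ
    refine ⟨g, hg1, hg2, hg3.trans ?_⟩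
    have h2 := mul_le_mul_of_nonneg_left hzero hv.le
    have h3 := mul_le_mul_of_nonneg_right hμ2 (by positivity : (0 : ℝ) ≤ (l : ℝ) + 1)
    rw [hTs]
    linarith
  rcases hcase with hn2 | hn1
  · have hn2' : (2 : ℝ) ≤ n := by exact_mod_cast hn2
    obtain ⟨hml, hbr⟩ := hmlroot hn2
    -- `23 / 20` is below `√(4 / 3)`, as the zero flow requires, and large enough to pay for the
    -- root: `(2 - 63 / 40) * (23 / 20) ≥ 12 / 25`
    rcases le_or_gt s (23 / 20) with hs1 | hs1
    · refine hsmall ?_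
      have hl' : (l : ℝ) + 1 ≤ 3 / 2 * n := by
        have : (l : ℝ) ≤ n := by exact_mod_cast hln
        linarith
      have h2 := mul_le_mul_of_nonneg_left hl' (sq_nonneg V)
      have h3 : s ^ 2 ≤ 4 / 3 := by nlinarith
      have h4 := mul_le_mul_of_nonneg_right (mul_le_mul_of_nonneg_left h3 hs0) hvL.le
      nlinarith
    · have hHL : (harmonic l : ℝ) ≤ L :=
        (harmonic_cast_mono hln).trans (harmonic_le_one_add_log n)
      obtain ⟨k, hk⟩ := exists_levels hml hv hL0 hs0 hs3 hHL
        (fun j => (hpath j).2 ⟨0, hl⟩) (hroot.trans hμV)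
      obtain ⟨g, hg1, hg2, hg3⟩ := exists_bound_of_levels hl v hμ k
      refine ⟨g, hg1, hg2, (hg3.trans hk).trans ?_⟩
      rw [hTs]
      have h2 := mul_le_mul_of_nonneg_right hs1.le hL0.le
      have h3 : 1 + m * (harmonic l : ℝ) / 2 + 63 / 40 * s * L ≤ x * L + 2 * (s * L) := by
        linarith
      have h4 := mul_le_mul_of_nonneg_left h3 hv.le
      linarith
  · obtain ⟨rfl, rfl⟩ := hone hn1
    have hL' : L = 1 := by rw [hL, hn1]; simp
    have hn1' : (n : ℝ) = 1 := by rw [hn1]; simp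
    rcases le_or_gt s 1 with hs1 | hs1
    · refine hsmall ?_
      rw [hn1', one_mul] at hs3
      rw [← hs3]
      have h3 : s ^ 2 ≤ 1 := by nlinarith
      have h4 := mul_le_mul_of_nonneg_right (mul_le_mul_of_nonneg_left h3 hs0) hvL.le
      push_cast
      nlinarith
    · obtain ⟨g, hg1, hg2, hg3⟩ := exists_bound_of_noise (spiderTree 1 1) v hμ
      refine ⟨g, hg1, hg2, ?_⟩
      rw [hg3, hTs, hL']
      have h2 := mul_le_mul_of_nonneg_right hs1.le hv.le
      have h3 := mul_le_mul_of_nonneg_right hx0 hv.le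
      have : Fintype.card (Option (Fin 1 × Fin 1)) = 2 := rfl
      rw [this]
      push_cast
      linarith

/-- The bound on the summed squared error through maximal noise sums. It holds for all `α < 1`, and
its powers of `log (e n)` are smaller than those of the theorem. -/
theorem exists_bound_of_lt_one {n : ℕ} {α V : ℝ} (σ : ℝ≥0) (hn : 1 ≤ n) (h0 : 0 < α)
    (h1 : α < 1) (hV : 0 ≤ V) {μ : Option (Fin ⌈(n : ℝ) ^ α⌉₊ × Fin ⌈(n : ℝ) ^ (1 - α)⌉₊) → ℝ}
    (hμ : μ ∈ (deepTree α n).flows) (hμV : μ none ≤ V) :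
    ∃ g, Integrable g (iidGaussian _ (σ ^ 2)) ∧
      (∀ ε, ∑ i, ((deepTree α n).leastSquares (μ + ε) i - μ i) ^ 2 ≤ g ε) ∧
      ∫ ε, g ε ∂iidGaussian _ (σ ^ 2)
        ≤ 100 * ((σ : ℝ) ^ 2 * (1 + Real.log n) ^ 2 * (n : ℝ) ^ (1 - α)
            + V * σ * (1 + Real.log n) * (n : ℝ) ^ (1 - α)) := by
  have hn0 : (1 : ℝ) ≤ n := by exact_mod_cast hn
  have hL1 : 1 ≤ 1 + Real.log n := by linarith [Real.log_nonneg hn0]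
  have hl : 0 < ⌈(n : ℝ) ^ (1 - α)⌉₊ := Nat.ceil_pos.2 (by positivity)
  have hx1 : 1 ≤ (n : ℝ) ^ α := Real.one_le_rpow hn0 h0.le
  have hy1 : 1 ≤ (n : ℝ) ^ (1 - α) := Real.one_le_rpow hn0 (by linarith)
  have hxy : (n : ℝ) ^ α * (n : ℝ) ^ (1 - α) = n := by
    rw [← Real.rpow_add (by linarith), add_sub_cancel, Real.rpow_one]
  have hm2 := Nat.ceil_lt_add_one (a := (n : ℝ) ^ α) (by linarith)
  have hl2 := Nat.ceil_lt_add_one (a := (n : ℝ) ^ (1 - α)) (by linarith)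
  have hnL : (n : ℝ) * Real.exp 1 = Real.exp (1 + Real.log n) := by
    rw [Real.exp_add, Real.exp_log (by linarith), mul_comm]
  unfold deepTree at *
  set L := 1 + Real.log n with hL
  set x := (n : ℝ) ^ α with hx
  set y := (n : ℝ) ^ (1 - α) with hy
  generalize ⌈x⌉₊ = m at *
  generalize ⌈y⌉₊ = l at *
  rcases eq_or_ne σ 0 with rfl | hσ
  · obtain ⟨g, hg1, hg2, hg3⟩ := exists_bound_of_noise (spiderTree m l) (0 ^ 2) hμ
    exact ⟨g, hg1, hg2, by rw [hg3]; simp⟩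
  have hσ0 : (0 : ℝ) < σ := NNReal.coe_pos.2 (pos_iff_ne_zero.2 hσ)
  have hl1 : (1 : ℝ) ≤ l := by exact_mod_cast hl
  have hsl1 : 1 ≤ √(l : ℝ) := Real.one_le_sqrt.2 hl1
  have hsl2 : √(l : ℝ) ^ 2 = l := Real.sq_sqrt (by linarith)
  have hL0 : 0 < L := by linarith
  -- with `K = 3 L` the factor `exp (-K)` outweighs the number `m (l + 1) ≤ 6 n` of segments
  obtain ⟨g, hg1, hg2, hg3⟩ := exists_bound_of_prefixMax (V := V) (τ := σ * √(l : ℝ))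
    (K := 3 * L) (A := σ * √(l : ℝ) * L) hl (σ ^ 2) hV (by positivity)
    (by rw [mul_pow, hsl2]; push_cast; ring) (by positivity) (by positivity) hμ hμV
  refine ⟨g, hg1, hg2, hg3.trans ?_⟩
  push_cast
  have hcount : 4 * (Real.exp (-(3 * L)) * (m * ((l + 1) * Real.exp (1 / 2)))) ≤ 5 := by
    have h2 : (m : ℝ) * (l + 1) ≤ 6 * n := by
      calc (m : ℝ) * (l + 1) ≤ (2 * x) * (3 * y) := by gcongr <;> linarith
        _ = 6 * n := by rw [← hxy]; ring
    have h3 : Real.exp (-(3 * L)) * (n * Real.exp (1 / 2)) ≤ 1 / 5 := by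
      have e1 : (n : ℝ) = Real.exp (L - 1) := by
        rw [Real.exp_sub, ← hnL]; field_simp
      rw [e1, ← Real.exp_add, ← Real.exp_add]
      calc Real.exp (-(3 * L) + (L - 1 + 1 / 2)) ≤ Real.exp (-2) :=
            Real.exp_le_exp.2 (by linarith)
        _ = (Real.exp 1 ^ 2)⁻¹ := by rw [Real.exp_neg, ← Real.exp_nat_mul]; norm_num
        _ ≤ 1 / 5 := by
            rw [one_div]
            exact inv_anti₀ (by norm_num) (by nlinarith [Real.exp_one_gt_d9])
    have h4 : Real.exp (-(3 * L)) * (m * ((l + 1) * Real.exp (1 / 2)))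
        ≤ 6 * (Real.exp (-(3 * L)) * (n * Real.exp (1 / 2))) := by
      have := mul_le_mul_of_nonneg_left h2
        (by positivity : 0 ≤ Real.exp (-(3 * L)) * Real.exp (1 / 2))
      linarith
    linarith
  have hS : 2 * (σ : ℝ) ^ 2 + 2 * (σ ^ 2 * l) * (2 * (3 * L) ^ 2
      + 4 * (Real.exp (-(3 * L)) * (m * ((l + 1) * Real.exp (1 / 2)))))
      ≤ 48 * ((σ : ℝ) ^ 2 * l * L ^ 2) := by
    have h2 : 0 ≤ (σ : ℝ) ^ 2 * l := by positivity
    have h3 := mul_le_mul_of_nonneg_left hcount h2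
    have h4 : (1 : ℝ) ≤ L ^ 2 := one_le_pow₀ hL1
    have h5 := mul_le_mul_of_nonneg_left h4 h2
    have h6 := mul_le_mul_of_nonneg_left hl1 (sq_nonneg (σ : ℝ))
    linarith
  set S := 2 * (σ : ℝ) ^ 2 + 2 * (σ ^ 2 * l) * (2 * (3 * L) ^ 2
      + 4 * (Real.exp (-(3 * L)) * (m * ((l + 1) * Real.exp (1 / 2)))))
  have hSA : S / (σ * √(l : ℝ) * L) + σ * √(l : ℝ) * L ≤ 49 * (σ * l * L) := by
    have h2 : S / (σ * √(l : ℝ) * L) ≤ 48 * (σ * √(l : ℝ) * L) := by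
      rw [div_le_iff₀ (by positivity)]
      refine hS.trans (le_of_eq ?_)
      linear_combination (-48 * (σ : ℝ) ^ 2 * L ^ 2) * hsl2
    have h3 : √(l : ℝ) ≤ l := by nlinarith
    have h4 : σ * √(l : ℝ) * L ≤ σ * l * L := by gcongr
    linarith
  have hl3 : (l : ℝ) ≤ 2 * y := by linarith
  calc V * (S / (σ * √(l : ℝ) * L) + σ * √(l : ℝ) * L) + S
      ≤ V * (49 * (σ * l * L)) + 48 * ((σ : ℝ) ^ 2 * l * L ^ 2) := by gcongr
    _ ≤ V * (49 * (σ * (2 * y) * L)) + 48 * ((σ : ℝ) ^ 2 * (2 * y) * L ^ 2) := by gcongr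
    _ ≤ 100 * ((σ : ℝ) ^ 2 * L ^ 2 * y + V * σ * L * y) := by
        have h2 : 0 ≤ (σ : ℝ) ^ 2 * L ^ 2 * y := by positivity
        have h3 : 0 ≤ V * σ * L * y := by positivity
        linarith

theorem mainTheorem6 :
    (∀ (n : ℕ) (α : ℝ) (σ : ℝ≥0) (V : ℝ), 1 ≤ n → 0 < α → α ≤ 1 / 3 → 0 ≤ V →
      (deepTree α n).worstCaseRisk n σ V ≤ ENNReal.ofReal
        (2 * ((σ : ℝ) ^ 2 * V * Real.log (Real.exp 1 * n) / n) ^ (2 / 3 : ℝ)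
          + (σ : ℝ) ^ 2 * Real.log (Real.exp 1 * n) / (n : ℝ) ^ (1 - α))) ∧
    (∃ C : ℝ, 0 < C ∧
      ∀ (n : ℕ) (α : ℝ) (σ : ℝ≥0) (V : ℝ), 1 ≤ n → 1 / 3 ≤ α → α < 1 → 0 ≤ V →
        (deepTree α n).worstCaseRisk n σ V ≤ ENNReal.ofReal
          (C / n * ((σ : ℝ) ^ 2 * Real.log (Real.exp 1 * n) ^ 3 * (n : ℝ) ^ (1 - α)
            + V * σ * Real.log (Real.exp 1 * n) ^ (3 / 2 : ℝ) * (n : ℝ) ^ (1 - α)))) := by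
  refine ⟨fun n α σ V hn h0 h1 hV => ?_, 100, by norm_num, fun n α σ V hn h0 h1 hV => ?_⟩
  · rw [log_exp_one_mul hn]
    refine ((deepTree α n).worstCaseRisk_le n σ V _ fun μ hμ hμV =>
      exists_bound_of_le_one_third (σ ^ 2) hn h0 h1 hV μ hμ hμV).trans_eq ?_
    have hn0 : (n : ℝ) ≠ 0 := by positivity
    congr 1
    rw [rpow_one_sub_eq hn]
    push_cast
    field_simp
    ring
  · rw [log_exp_one_mul hn]
    refine ((deepTree α n).worstCaseRisk_le n σ V _ fun μ hμ hμV =>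
      exists_bound_of_lt_one σ hn (by linarith) h1 hV hμ hμV).trans
      (ENNReal.ofReal_le_ofReal ?_)
    have hn0 : (1 : ℝ) ≤ n := by exact_mod_cast hn
    have hL1 : 1 ≤ 1 + Real.log n := by linarith [Real.log_nonneg hn0]
    have h2 : (1 + Real.log n) ^ 2 ≤ (1 + Real.log n) ^ 3 := pow_le_pow_right₀ hL1 (by norm_num)
    have h3 : 1 + Real.log n ≤ (1 + Real.log n) ^ (3 / 2 : ℝ) :=
      Real.self_le_rpow_of_one_le hL1 (by norm_num)
    rw [← mul_assoc, one_div_mul_eq_div]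
    gcongr
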